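/- Let $(X,\mathcal B,p)$ be a standard Lebesgue probability space, i.e. a standard Borel space with a non-atomic probability measure $p$. A \emph{map} of $(X,\mathcal B,p)$ is an invertible measure-preserving transformation $\tau:X\to X$ (with $\tau$ and $\tau^{-1}$ measurable). Let $\mathcal T$ be the set of all maps with the weak topology, that is, the topology generated by the sets $\{\tau\in\mathcal T: p(\tau A\,\triangle\,\tau_0A)<\epsilon\}$ with $\tau_0\in\mathcal T$, $A\in\mathcal B$ and $\epsilon>0$, and give $\mathcal T\times\mathcal T$ the product topology. For $1\le r\le\infty$ let $L_r^0(X)$ be the space of (real or complex) functions $h\in L_r(X)$ with $\int h\,dp=0$. Proposition. The generic pair of maps $(\sigma,\tau)$ has no non-trivial common coboundary with transfer functions in $L_r^0(X)$, $1\le r\le\infty$. That is, there is a dense $G_\delta$ set $\mathcal G\subset\mathcal T\times\mathcal T$ such that for every $(\sigma,\tau)\in\mathcal G$ and every $r$ with $1\le r\le\infty$: if $f=h-h\circ\tau=g-g\circ\sigma$ almost everywhere with $h,g\in L_r^0(X)$, then $f=0$ almost everywhere. -/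

import Mathlib

open MeasureTheory
open scoped ENNReal

/-- A *map* of the probability space `(X, p)`: an invertible, bimeasurable, measure-preserving
transformation of `(X, p)`. -/
structure MPMap {X : Type*} [MeasurableSpace X] (p : Measure X) where
  /-- the underlying measurable bijection -/
  toEquiv : X ≃ᵐ X
  measurePreserving : MeasurePreserving toEquiv p p

namespace MPMap

variable {X : Type*} [MeasurableSpace X] {p : Measure X}

instance : CoeFun (MPMap p) (fun _ => X → X) := ⟨fun τ => τ.toEquiv⟩

/-- The basic weak neighbourhood `{τ : p (τ A ∆ τ₀ A) < ε}` of `τ₀`. -/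
def weakBall (τ₀ : MPMap p) (A : Set X) (ε : ℝ≥0∞) : Set (MPMap p) :=
  {τ | p (symmDiff (τ '' A) (τ₀ '' A)) < ε}

/-- The weak topology on maps: the topology generated by the pseudometrics
`(τ, τ₀) ↦ p (τ A ∆ τ₀ A)`, `A` measurable. Maps that agree almost everywhere are topologically
indistinguishable, so open, dense and `G_δ` sets of maps are the same as those of classes of maps
modulo almost everywhere equality. -/
instance weakTopology : TopologicalSpace (MPMap p) :=
  TopologicalSpace.generateFrom
    {U | ∃ (τ₀ : MPMap p) (A : Set X) (ε : ℝ≥0∞),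
      MeasurableSet A ∧ 0 < ε ∧ U = weakBall τ₀ A ε}

/-- `f` is a `τ`-coboundary with transfer function in `L_r^0(X)`, the mean-zero functions in
`L_r(X)`: `f = h - h ∘ τ` almost everywhere for some `h ∈ L_r^0(X)`. -/
def IsCoboundary {𝕜 : Type*} [RCLike 𝕜] (τ : MPMap p) (r : ℝ≥0∞) (f : X → 𝕜) : Prop :=
  ∃ h : X → 𝕜, MemLp h r p ∧ ∫ x, h x ∂p = 0 ∧ f =ᵐ[p] fun x => h x - h (τ x)

/-- `σ` and `τ` have no non-trivial common coboundary (among `𝕜`-valued functions) with transfer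
functions in `L_r^0(X)`. -/
def NoCommonCoboundary (𝕜 : Type*) [RCLike 𝕜] (σ τ : MPMap p) (r : ℝ≥0∞) : Prop :=
  ∀ f : X → 𝕜, IsCoboundary σ r f → IsCoboundary τ r f → f =ᵐ[p] 0

end MPMap

/-!
Let `e : X → ℝ` be a measurable embedding. An integrable function with vanishing integrals over `X`
and over the sets `A = e⁻¹ (-∞, q]`, `q` rational, is null. So it suffices to find, for each such `A`
and each precision, an open dense set of pairs `(σ, τ)` whose common coboundaries have almost
vanishing integral over `A`.

The mechanism is duality. Suppose `1_A = φ - ψ` with `φ` bounded and `σ`-invariant, `ψ` bounded and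
`τ`-invariant. If `f = g - g ∘ σ = h - h ∘ τ`, then `∫_A f = ∫ f φ - ∫ f ψ = 0`, since a coboundary
integrates to zero against an invariant function. There are enough such pairs
(`dense_iUnion_almostSplit`). Given `(σ₁, τ₁)` and a finite partition into cells, take `φ` uniformly
distributed on `{0, …, L - 1}` and independent of all the cells and of `A`. The cells can be moved as
`σ₁` moves them while `φ` is preserved. The law of `φ - 1_A` conditional on a cell is a mixture of two
uniform laws that are translates of each other by one, so away from its two extreme values
`φ - 1_A` is independent of the cells as well, and the cells can be moved as `τ₁` moves them, up to
measure `1 / L`, while `φ - 1_A` is preserved (`exists_invariant_split`). The exact maps come from the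
fact that two countable labellings with the same law are conjugate by a map
(`exists_mpMap_of_map_eq`), which is proved by adjoining to each label a uniform coordinate.

For `(σ, τ)` weakly close to such a pair, `φ` and `ψ` fail to be invariant on a set `E` of tiny
measure. As transfer functions are only integrable and `φ`, `ψ` have size `L`, the error cannot be
bounded by measure alone. Instead, `φ` and `ψ` are multiplied by a cutoff `χ` vanishing on `E`, equal
to one off a ball around `E` in the orbit graph of `σ` and `τ`, and varying by at most `1 / N` along
edges (`exists_cutoff`). Then `χ φ` and `χ ψ` are almost invariant uniformly, with difference
`χ 1_A`, which gives `|∫_A χ f| ≤ (‖g‖₁ + ‖h‖₁) / (n + 1)`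
(`exists_cutoff_norm_setIntegral_le`), and `χ` tends to one in measure as the precision increases.

Density of the intersection requires the Baire property. The weak topology is induced by
`τ ↦ (e ∘ τ, e ∘ τ⁻¹) ∈ L¹ × L¹`, for a bounded embedding `e`, and the range of this map is closed
(`isClosed_range_coordinates`), so the space of maps is completely pseudometrizable.
-/

open Set Filter Topology

namespace MPMap

/-! ### Maps from almost everywhere inverse pairs -/

section Upgrade

variable {X : Type*} [MeasurableSpace X] [StandardBorelSpace X] {p : Measure X}

theorem ae_rightInverse {S T : X → X} (hS : MeasurePreserving S p p) (hT : Measurable T)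
    (h : ∀ᵐ x ∂p, T (S x) = x) : ∀ᵐ x ∂p, S (T x) = x := by
  have hm : MeasurableSet {x | S (T x) = x} :=
    measurableSet_eq_fun (hS.measurable.comp hT) measurable_id
  rw [← hS.map_eq, ae_map_iff hS.measurable.aemeasurable hm]
  filter_upwards [h] with x hx
  rw [hx]

/-- A measure-preserving map with a measure-preserving left inverse, up to null sets, agrees almost
everywhere with an invertible map: both are cut down to the invariant conull set of points at which
all forward and backward iterates are inverted, and the identity is used elsewhere. -/
theorem exists_ae_eq_of_ae_leftInverse {S T : X → X} (hS : MeasurePreserving S p p)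
    (hT : MeasurePreserving T p p) (h : ∀ᵐ x ∂p, T (S x) = x) :
    ∃ τ : MPMap p, τ =ᵐ[p] S ∧ τ.toEquiv.symm =ᵐ[p] T := by
  classical
  set Y : Set X := {x | T (S x) = x} ∩ {x | S (T x) = x} with hY
  have hYm : MeasurableSet Y :=
    (measurableSet_eq_fun (hT.measurable.comp hS.measurable) measurable_id).inter
      (measurableSet_eq_fun (hS.measurable.comp hT.measurable) measurable_id)
  have hYae : ∀ᵐ x ∂p, x ∈ Y := by
    filter_upwards [h, ae_rightInverse hS hT.measurable h] with x h1 h2 using ⟨h1, h2⟩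
  set D : Set X := ⋂ n : ℕ, (S^[n] ⁻¹' Y ∩ T^[n] ⁻¹' Y) with hD
  have hDm : MeasurableSet D := MeasurableSet.iInter fun n =>
    ((hS.measurable.iterate n) hYm).inter ((hT.measurable.iterate n) hYm)
  have hDae : ∀ᵐ x ∂p, x ∈ D := by
    have : ∀ n : ℕ, ∀ᵐ x ∂p, x ∈ S^[n] ⁻¹' Y ∩ T^[n] ⁻¹' Y := fun n => by
      filter_upwards [(hS.iterate n).quasiMeasurePreserving.ae hYae,
        (hT.iterate n).quasiMeasurePreserving.ae hYae] with x h1 h2 using ⟨h1, h2⟩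
    filter_upwards [ae_all_iff.2 this] with x hx using mem_iInter.2 hx
  have key : ∀ x, x ∈ D ↔ ∀ n : ℕ, S^[n] x ∈ Y ∧ T^[n] x ∈ Y := fun x => by
    simp [hD]
  have hDY : ∀ x ∈ D, T (S x) = x ∧ S (T x) = x := fun x hx => ((key x).1 hx 0).1
  have hSD : ∀ x ∈ D, S x ∈ D := fun x hx => by
    rw [key] at hx ⊢
    rintro (_ | n)
    · exact ⟨(hx 1).1, (hx 1).1⟩
    · refine ⟨(hx (n + 2)).1, ?_⟩
      rw [Function.iterate_succ_apply, show T (S x) = x from (hx 0).1.1]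
      exact (hx n).2
  have hTD : ∀ x ∈ D, T x ∈ D := fun x hx => by
    rw [key] at hx ⊢
    rintro (_ | n)
    · exact ⟨(hx 1).2, (hx 1).2⟩
    · refine ⟨?_, (hx (n + 2)).2⟩
      rw [Function.iterate_succ_apply, show S (T x) = x from (hx 0).1.2]
      exact (hx n).1
  let τ : X ≃ᵐ X :=
    { toFun := D.piecewise S id
      invFun := D.piecewise T id
      left_inv := fun x => by
        by_cases hx : x ∈ D
        · simp [hx, hSD x hx, (hDY x hx).1]
        · simp [hx]
      right_inv := fun x => by
        by_cases hx : x ∈ D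
        · simp [hx, hTD x hx, (hDY x hx).2]
        · simp [hx]
      measurable_toFun := hS.measurable.piecewise hDm measurable_id
      measurable_invFun := hT.measurable.piecewise hDm measurable_id }
  have h1 : (τ : X → X) =ᵐ[p] S := by
    filter_upwards [hDae] with x hx
    exact piecewise_eq_of_mem D S id hx
  have h2 : (τ.symm : X → X) =ᵐ[p] T := by
    filter_upwards [hDae] with x hx
    exact piecewise_eq_of_mem D T id hx
  exact ⟨⟨τ, τ.measurable, by rw [Measure.map_congr h1, hS.map_eq]⟩, h1, h2⟩

end Upgrade

/-! ### Uniform coordinates and labellings with the same law -/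

section Uniformization

theorem continuous_cdf (μ : Measure ℝ) [IsProbabilityMeasure μ] [NullSingletonClass μ] :
    Continuous (ProbabilityTheory.cdf μ) := by
  set F := ProbabilityTheory.cdf μ with hF
  rw [continuous_iff_continuousAt]
  intro x
  rw [F.mono.continuousAt_iff_leftLim_eq_rightLim, F.rightLim_eq]
  have h := F.measure_singleton x
  rw [hF, ProbabilityTheory.measure_cdf, measure_singleton, ← hF] at h
  have h1 := ENNReal.ofReal_eq_zero.1 h.symm
  exact le_antisymm (F.mono.leftLim_le le_rfl) (by linarith)

/-- The cumulative distribution function of a non-atomic law pushes it to Lebesgue measure on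
`[0, 1]`. -/
theorem map_cdf_eq (μ : Measure ℝ) [IsProbabilityMeasure μ] [NullSingletonClass μ] :
    μ.map (ProbabilityTheory.cdf μ) = volume.restrict (Icc (0 : ℝ) 1) := by
  have hcont := continuous_cdf μ
  have hiic := ProbabilityTheory.ofReal_cdf μ
  have h0 := ProbabilityTheory.cdf_nonneg μ
  have h1 := ProbabilityTheory.cdf_le_one μ
  have htop := ProbabilityTheory.tendsto_cdf_atTop μ
  have hbot := ProbabilityTheory.tendsto_cdf_atBot μ
  have hmono : Monotone (ProbabilityTheory.cdf μ) := ProbabilityTheory.monotone_cdf μ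
  generalize (ProbabilityTheory.cdf μ : ℝ → ℝ) = F at *
  have : IsProbabilityMeasure (μ.map F) :=
    Measure.isProbabilityMeasure_map hcont.measurable.aemeasurable
  refine Measure.ext_of_Iic _ _ fun v => ?_
  rw [Measure.map_apply hcont.measurable measurableSet_Iic, Measure.restrict_apply measurableSet_Iic]
  rcases lt_or_ge v 0 with hv | hv
  · have e1 : F ⁻¹' Iic v = ∅ := by
      ext x; simp only [mem_preimage, mem_Iic, mem_empty_iff_false, iff_false]; linarith [h0 x]
    have e2 : Iic v ∩ Icc 0 1 = ∅ := by
      ext x; simp only [mem_inter_iff, mem_Iic, mem_Icc, mem_empty_iff_false, iff_false]; grind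
    rw [e1, e2]; simp
  rcases le_or_gt 1 v with hv' | hv'
  · have e1 : F ⁻¹' Iic v = univ := by
      ext x; simp only [mem_preimage, mem_Iic, mem_univ, iff_true]; linarith [h1 x]
    have e2 : Iic v ∩ Icc 0 1 = Icc 0 1 := by
      ext x; simp only [mem_inter_iff, mem_Iic, mem_Icc]; grind
    rw [e1, e2]; simp
  have e2 : Iic v ∩ Icc 0 1 = Icc 0 v := by
    ext x; simp only [mem_inter_iff, mem_Iic, mem_Icc]; grind
  rw [e2, Real.volume_Icc, sub_zero]
  rcases (F ⁻¹' Iic v).eq_empty_or_nonempty with he | hne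
  · have : v = 0 := by
      refine le_antisymm ?_ hv
      refine ge_of_tendsto hbot (Eventually.of_forall fun x => ?_)
      by_contra hx
      exact (he ▸ (show x ∈ F ⁻¹' Iic v from (not_le.1 hx).le) : x ∈ (∅ : Set ℝ))
    rw [he, this]; simp
  obtain ⟨b, hb⟩ := (htop.eventually (lt_mem_nhds hv')).exists
  have hbdd : BddAbove (F ⁻¹' Iic v) := ⟨b, fun x hx => by
    by_contra hxb
    exact absurd (hmono (not_le.1 hxb).le) (not_le.2 (lt_of_le_of_lt hx hb))⟩
  have hmem : F (sSup (F ⁻¹' Iic v)) ≤ v :=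
    (isClosed_Iic.preimage hcont).csSup_mem hne hbdd
  set s := sSup (F ⁻¹' Iic v) with hs
  have hge : v ≤ F s := by
    have : Tendsto F (𝓝[>] s) (𝓝 (F s)) := hcont.continuousAt.continuousWithinAt
    refine ge_of_tendsto this (eventually_nhdsWithin_of_forall fun y hy => ?_)
    by_contra hyv
    exact absurd (le_csSup hbdd (show y ∈ F ⁻¹' Iic v from (not_le.1 hyv).le)) (not_le.2 hy)
  have e1 : F ⁻¹' Iic v = Iic s := by
    ext x
    exact ⟨fun hx => le_csSup hbdd hx, fun hx => (hmono hx).trans hmem⟩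
  rw [e1, ← hiic, le_antisymm hmem hge]

/-- The cumulative distribution function of a non-atomic law is injective on a conull set: two
points at which it takes the same value are separated by a rational `q`, hence lie in the fibre of
`cdf μ q`, and fibres are null. -/
theorem exists_injOn_cdf (μ : Measure ℝ) [IsProbabilityMeasure μ] [NullSingletonClass μ] :
    ∃ D : Set ℝ, MeasurableSet D ∧ μ Dᶜ = 0 ∧ InjOn (ProbabilityTheory.cdf μ) D := by
  have hcont := continuous_cdf μ
  have hmap := map_cdf_eq μ
  have hmono : Monotone (ProbabilityTheory.cdf μ) := ProbabilityTheory.monotone_cdf μ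
  generalize (ProbabilityTheory.cdf μ : ℝ → ℝ) = F at *
  have hnull : ∀ q : ℚ, μ (F ⁻¹' {F q}) = 0 := fun q => by
    rw [← Measure.map_apply hcont.measurable (measurableSet_singleton _), hmap]
    simp
  refine ⟨(⋃ q : ℚ, F ⁻¹' {F q})ᶜ,
    (MeasurableSet.iUnion fun q => hcont.measurable (measurableSet_singleton _)).compl,
    by rw [compl_compl]; exact measure_iUnion_null hnull, ?_⟩
  have key : ∀ x y, x ∈ (⋃ q : ℚ, F ⁻¹' {F q})ᶜ → F x = F y → ¬ x < y := by
    intro x y hx hxy hlt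
    obtain ⟨q, hq1, hq2⟩ := exists_rat_btwn hlt
    refine hx (mem_iUnion.2 ⟨q, ?_⟩)
    exact le_antisymm (hmono hq1.le) (hxy ▸ hmono hq2.le)
  intro x hx y hy hxy
  exact le_antisymm (not_lt.1 (key y x hy hxy.symm)) (not_lt.1 (key x y hx hxy))

variable {X : Type*} [MeasurableSpace X] [StandardBorelSpace X]

/-- A non-atomic standard Borel probability space admits an almost everywhere injective map to
`[0, 1]` that pushes its measure to Lebesgue measure. -/
theorem exists_map_eq_volume (μ : Measure X) [IsProbabilityMeasure μ] [NullSingletonClass μ] :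
    ∃ (F : X → ℝ) (D : Set X), Measurable F ∧ μ.map F = volume.restrict (Icc (0 : ℝ) 1) ∧
      MeasurableSet D ∧ μ Dᶜ = 0 ∧ InjOn F D := by
  set e := embeddingReal X
  have he : MeasurableEmbedding e := measurableEmbedding_embeddingReal X
  have : IsProbabilityMeasure (μ.map e) :=
    Measure.isProbabilityMeasure_map he.measurable.aemeasurable
  have : NullSingletonClass (μ.map e) := ⟨fun t => by
    rw [he.map_apply]
    exact ((subsingleton_singleton).preimage he.injective).measure_zero μ⟩
  obtain ⟨D, hDm, hD0, hinj⟩ := exists_injOn_cdf (μ.map e)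
  have hc := (continuous_cdf (μ.map e)).measurable
  refine ⟨fun x => ProbabilityTheory.cdf (μ.map e) (e x), e ⁻¹' D, hc.comp he.measurable, ?_,
    he.measurable hDm, ?_, fun x hx y hy hxy => he.injective (hinj hx hy hxy)⟩
  · rw [← map_cdf_eq (μ.map e), Measure.map_map hc he.measurable]
    rfl
  · rwa [he.map_apply] at hD0

/-- Relative uniformization over a countable labelling `α`: some real coordinate `F` is uniformly
distributed on `[0, 1]` and independent of `α`, and `(α, F)` is injective on a conull set. -/
theorem exists_independent_uniform {ι : Type*} [MeasurableSpace ι] [Countable ι]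
    [MeasurableSingletonClass ι] (p : Measure X) [IsProbabilityMeasure p] [NullSingletonClass p]
    {α : X → ι} (hα : Measurable α) :
    ∃ (F : X → ℝ) (D : Set X), Measurable F ∧
      p.map (fun x => (α x, F x)) = (p.map α).prod (volume.restrict (Icc (0 : ℝ) 1)) ∧
      MeasurableSet D ∧ p Dᶜ = 0 ∧ InjOn (fun x => (α x, F x)) D := by
  classical
  have hfib : ∀ k : ι, MeasurableSet (α ⁻¹' {k}) := fun k => hα (measurableSet_singleton k)
  -- On each fibre of positive measure the normalized restriction is uniformized.
  have hex : ∀ k : ι, ∃ (F : X → ℝ) (D : Set X), Measurable F ∧ MeasurableSet D ∧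
      (p.restrict (α ⁻¹' {k})).map F = p (α ⁻¹' {k}) • volume.restrict (Icc (0 : ℝ) 1) ∧
      p (α ⁻¹' {k} ∩ Dᶜ) = 0 ∧ InjOn F D := fun k => by
    by_cases h0 : p (α ⁻¹' {k}) = 0
    · refine ⟨fun _ => 0, ∅, measurable_const, MeasurableSet.empty, ?_,
        measure_mono_null inter_subset_left h0, injOn_empty _⟩
      rw [Measure.restrict_eq_zero.2 h0, h0]
      simp
    have : IsProbabilityMeasure (ProbabilityTheory.cond p (α ⁻¹' {k})) :=
      ProbabilityTheory.cond_isProbabilityMeasure h0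
    have : NullSingletonClass (ProbabilityTheory.cond p (α ⁻¹' {k})) := ⟨fun x =>
      ProbabilityTheory.cond_absolutelyContinuous (measure_singleton x)⟩
    obtain ⟨F, D, hF, hmap, hD, hD0, hinj⟩ :=
      exists_map_eq_volume (ProbabilityTheory.cond p (α ⁻¹' {k}))
    have hcond : p.restrict (α ⁻¹' {k}) =
        p (α ⁻¹' {k}) • ProbabilityTheory.cond p (α ⁻¹' {k}) := by
      rw [ProbabilityTheory.cond, smul_smul, ENNReal.mul_inv_cancel h0 (measure_ne_top _ _),
        one_smul]
    refine ⟨F, D, hF, hD, by rw [hcond, Measure.map_smul, hmap], ?_, hinj⟩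
    rw [inter_comm, ← Measure.restrict_apply hD.compl, hcond, Measure.smul_apply, hD0, smul_zero]
  choose F D hF hD hmap hD0 hinj using hex
  have hFm : Measurable fun x => F (α x) x :=
    (measurable_from_prod_countable_right (f := fun q : ι × X => F q.1 q.2) hF).comp
      (hα.prodMk measurable_id)
  have hEm : MeasurableSet {x | x ∈ D (α x)} := by
    have : {x | x ∈ D (α x)} = ⋃ k, α ⁻¹' {k} ∩ D k := by ext x; simp
    rw [this]
    exact MeasurableSet.iUnion fun k => (hfib k).inter (hD k)
  refine ⟨fun x => F (α x) x, {x | x ∈ D (α x)}, hFm, ?_, hEm, ?_, ?_⟩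
  · have : IsProbabilityMeasure (p.map α) := Measure.isProbabilityMeasure_map hα.aemeasurable
    refine (Measure.prod_eq fun s t hs ht => ?_).symm
    rw [Measure.map_apply (hα.prodMk hFm) (hs.prod ht), Measure.map_apply hα hs]
    have hs1 : (fun x => (α x, F (α x) x)) ⁻¹' s ×ˢ t = ⋃ k ∈ s, F k ⁻¹' t ∩ α ⁻¹' {k} := by
      ext x; simp [and_comm]
    have hs2 : α ⁻¹' s = ⋃ k ∈ s, α ⁻¹' {k} := by ext x; simp
    have hdisj : s.PairwiseDisjoint fun k => α ⁻¹' {k} := fun i _ j _ hij =>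
      (disjoint_singleton.2 hij).preimage α
    rw [hs1, hs2, measure_biUnion s.to_countable hdisj fun k _ => hfib k,
      measure_biUnion s.to_countable (hdisj.mono fun k => inter_subset_right)
        fun k _ => (hF k ht).inter (hfib k), ← ENNReal.tsum_mul_right]
    refine tsum_congr fun k => ?_
    rw [← Measure.restrict_apply (hF k ht), ← Measure.map_apply (hF k) ht, hmap]
    simp
  · have : {x | x ∈ D (α x)}ᶜ = ⋃ k, α ⁻¹' {k} ∩ (D k)ᶜ := by ext x; simp
    rw [this]
    exact measure_iUnion_null hD0
  · intro x hx y hy hxy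
    obtain ⟨h1, h2⟩ := Prod.mk.inj hxy
    simp only [← h1] at h2
    refine hinj (α x) hx ?_ h2
    rw [h1]; exact hy

/-- Any two countable labellings of a non-atomic standard Borel probability space with the same
law are carried to each other by a map. -/
theorem exists_mpMap_of_map_eq {ι : Type*} [MeasurableSpace ι] [Countable ι]
    [MeasurableSingletonClass ι] (p : Measure X) [IsProbabilityMeasure p] [NullSingletonClass p]
    {α β : X → ι} (hα : Measurable α) (hβ : Measurable β) (h : p.map α = p.map β) :
    ∃ σ : MPMap p, ∀ᵐ x ∂p, β (σ x) = α x := by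
  obtain ⟨F, D, hF, hFl, hD, hD0, hFi⟩ := exists_independent_uniform p hα
  obtain ⟨G, E, hG, hGl, hE, hE0, hGi⟩ := exists_independent_uniform p hβ
  have hV : ∀ (W : X → ι × ℝ) (D : Set X), Measurable W → MeasurableSet D → p Dᶜ = 0 →
      InjOn W D → ∃ V : ι × ℝ → X, Measurable V ∧ ∀ᵐ x ∂p, V (W x) = x := by
    intro W D hW hD hD0 hi
    have : StandardBorelSpace D := hD.standardBorel
    have hemb : MeasurableEmbedding fun x : D => W x :=
      (hW.comp measurable_subtype_coe).measurableEmbedding fun x y hxy =>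
        Subtype.ext (hi x.2 y.2 hxy)
    obtain ⟨V, hVm, hV⟩ := hemb.exists_measurable_extend measurable_subtype_coe
      fun _ => nonempty_of_isProbabilityMeasure p
    refine ⟨V, hVm, ?_⟩
    filter_upwards [show ∀ᵐ x ∂p, x ∈ D from hD0] with x hx
    exact congrFun hV ⟨x, hx⟩
  have hW := hα.prodMk hF
  have hZ := hβ.prodMk hG
  set W : X → ι × ℝ := fun x => (α x, F x) with hWdef
  set Z : X → ι × ℝ := fun x => (β x, G x) with hZdef
  obtain ⟨V, hVm, hVW⟩ := hV W D hW hD hD0 hFi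
  obtain ⟨U, hUm, hUZ⟩ := hV Z E hZ hE hE0 hGi
  have hlaw : p.map W = p.map Z := by rw [hFl, hGl, h]
  have hmp : ∀ {V : ι × ℝ → X} {W Z : X → ι × ℝ}, Measurable V → Measurable W → Measurable Z →
      p.map W = p.map Z → (∀ᵐ x ∂p, V (Z x) = x) →
      MeasurePreserving (fun x => V (W x)) p p := by
    intro V W Z hV hW hZ hl hVZ
    refine ⟨hV.comp hW, ?_⟩
    change p.map (V ∘ W) = p
    rw [← Measure.map_map hV hW, hl, Measure.map_map hV hZ]
    exact (Measure.map_congr hVZ).trans Measure.map_id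
  have hZU : ∀ᵐ x ∂p, Z (U (W x)) = W x := by
    have hm : MeasurableSet {y : ι × ℝ | Z (U y) = y} :=
      measurableSet_eq_fun (hZ.comp hUm) measurable_id
    refine ae_of_ae_map (p := fun y => Z (U y) = y) hW.aemeasurable ?_
    rw [hlaw, ae_map_iff hZ.aemeasurable hm]
    filter_upwards [hUZ] with x hx
    rw [hx]
  obtain ⟨σ, hσ, -⟩ := exists_ae_eq_of_ae_leftInverse (hmp hUm hW hZ hlaw hUZ)
    (hmp hVm hZ hW hlaw.symm hVW) (by filter_upwards [hZU, hVW] with x h1 h2; rw [h1, h2])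
  refine ⟨σ, ?_⟩
  filter_upwards [hσ, hZU] with x h1 h2
  rw [h1]
  exact congrArg Prod.fst h2

end Uniformization

/-! ### Weak neighbourhoods -/

section WeakTopology

variable {X : Type*} [MeasurableSpace X] {p : Measure X}

theorem measurePreserving_symm (τ : MPMap p) : MeasurePreserving τ.toEquiv.symm p p :=
  τ.measurePreserving.symm

theorem image_eq_preimage_symm (τ : MPMap p) (A : Set X) :
    τ '' A = τ.toEquiv.symm ⁻¹' A :=
  τ.toEquiv.image_eq_preimage_symm A

theorem measure_preimage (τ : MPMap p) (A : Set X) : p (τ ⁻¹' A) = p A :=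
  τ.measurePreserving.measure_preimage_equiv A

theorem measure_image (τ : MPMap p) (A : Set X) : p (τ '' A) = p A := by
  rw [← τ.measure_preimage (τ '' A), preimage_image_eq _ τ.toEquiv.injective]

theorem isOpen_weakBall (τ₀ : MPMap p) {A : Set X} (hA : MeasurableSet A) {ε : ℝ≥0∞}
    (hε : 0 < ε) : IsOpen (weakBall τ₀ A ε) :=
  TopologicalSpace.isOpen_generateFrom_of_mem ⟨τ₀, A, ε, hA, hε, rfl⟩

theorem weakBall_mem_nhds (τ₀ : MPMap p) {A : Set X} (hA : MeasurableSet A) {ε : ℝ≥0∞}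
    (hε : 0 < ε) : weakBall τ₀ A ε ∈ 𝓝 τ₀ :=
  (isOpen_weakBall τ₀ hA hε).mem_nhds (by simpa [weakBall] using hε)

theorem exists_weakBall_subset {τ₀ τ₁ : MPMap p} {A : Set X} {ε : ℝ≥0∞}
    (h : τ₀ ∈ weakBall τ₁ A ε) : ∃ c : ℝ≥0∞, 0 < c ∧ weakBall τ₀ A c ⊆ weakBall τ₁ A ε := by
  refine ⟨ε - p (symmDiff (τ₀ '' A) (τ₁ '' A)), tsub_pos_of_lt h, fun τ hτ => ?_⟩
  exact lt_of_le_of_lt (measure_symmDiff_le _ (τ₀ '' A) _) (lt_tsub_iff_right.1 hτ)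

/-- A neighbourhood of a map contains all maps that move finitely many measurable sets to almost
the same places. -/
theorem exists_finite_forall_mem_of_mem_nhds {τ₀ : MPMap p} {V : Set (MPMap p)}
    (hV : V ∈ 𝓝 τ₀) : ∃ (𝓑 : Set (Set X)) (ε : ℝ≥0∞), 𝓑.Finite ∧ (∀ B ∈ 𝓑, MeasurableSet B) ∧
      0 < ε ∧ ∀ τ : MPMap p, (∀ B ∈ 𝓑, p (symmDiff (τ '' B) (τ₀ '' B)) < ε) → τ ∈ V := by
  obtain ⟨_, ⟨F, ⟨hF, hFg⟩, rfl⟩, hτ₀, hFV⟩ :=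
    (TopologicalSpace.isTopologicalBasis_of_subbasis
      (rfl : weakTopology (p := p) = _)).mem_nhds_iff.1 hV
  suffices ∃ (𝓑 : Set (Set X)) (ε : ℝ≥0∞), 𝓑.Finite ∧ (∀ B ∈ 𝓑, MeasurableSet B) ∧
      0 < ε ∧ ∀ τ : MPMap p, (∀ B ∈ 𝓑, p (symmDiff (τ '' B) (τ₀ '' B)) < ε) → τ ∈ ⋂₀ F by
    obtain ⟨𝓑, ε, h1, h2, h3, h4⟩ := this
    exact ⟨𝓑, ε, h1, h2, h3, fun τ hτ => hFV (h4 τ hτ)⟩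
  clear hFV hV
  induction F, hF using Set.Finite.induction_on with
  | empty => exact ⟨∅, 1, finite_empty, by simp, one_pos, by simp⟩
  | @insert s F _ _ ih =>
    obtain ⟨𝓑, ε, h1, h2, h3, h4⟩ := ih ((subset_insert _ _).trans hFg)
      fun t ht => hτ₀ t (mem_insert_of_mem _ ht)
    obtain ⟨τ₁, A, δ, hA, -, rfl⟩ := hFg (mem_insert _ _)
    obtain ⟨c, hc, hcs⟩ := exists_weakBall_subset (hτ₀ _ (mem_insert _ _))
    refine ⟨insert A 𝓑, min c ε, h1.insert A, ?_, lt_min hc h3, fun τ hτ => ?_⟩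
    · rintro B (rfl | hB)
      exacts [hA, h2 B hB]
    · rw [sInter_insert]
      exact ⟨hcs ((hτ A (mem_insert _ _)).trans_le (min_le_left _ _)),
        h4 τ fun B hB => (hτ B (mem_insert_of_mem _ hB)).trans_le (min_le_right _ _)⟩

theorem measure_symmDiff_image_left (τ : MPMap p) (A B : Set X) :
    p (symmDiff (τ '' A) B) = p (symmDiff A (τ ⁻¹' B)) := by
  rw [← τ.measure_image (symmDiff A _), image_symmDiff τ.toEquiv.injective,
    image_preimage_eq B τ.toEquiv.surjective]

theorem measure_symmDiff_preimage (τ τ₀ : MPMap p) (B : Set X) :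
    p (symmDiff (τ ⁻¹' B) (τ₀ ⁻¹' B)) =
      p (symmDiff (τ '' (τ₀ ⁻¹' B)) (τ₀ '' (τ₀ ⁻¹' B))) := by
  rw [measure_symmDiff_image_left, image_preimage_eq B τ₀.toEquiv.surjective, symmDiff_comm]

end WeakTopology

/-! ### Complete pseudometrizability of the weak topology -/

section Complete

variable {X : Type*} [MeasurableSpace X] {p : Measure X} [IsProbabilityMeasure p] {e : X → ℝ}

/-- Preimages under measure-preserving maps depend uniformly continuously on the maps, when these
are compared in `L¹` through a real coordinate `e`: a Borel set is squeezed between a compact and an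
open set of nearly the same measure, and these are a positive distance apart. -/
theorem exists_forall_measure_symmDiff_le (he : MeasurableEmbedding e) {A : Set X}
    (hA : MeasurableSet A) {ε : ℝ≥0∞} (hε : ε ≠ 0) :
    ∃ δ : ℝ≥0∞, 0 < δ ∧ ∀ S T : X → X, MeasurePreserving S p p → MeasurePreserving T p p →
      ∫⁻ x, ‖e (S x) - e (T x)‖ₑ ∂p < δ → p (symmDiff (S ⁻¹' A) (T ⁻¹' A)) ≤ ε := by
  have : IsProbabilityMeasure (p.map e) :=
    Measure.isProbabilityMeasure_map he.measurable.aemeasurable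
  have hC : MeasurableSet (e '' A) := he.measurableSet_image.2 hA
  have hε6 : ε / 6 ≠ 0 := by simp [hε]
  obtain ⟨K, hKC, hK, hKε⟩ := hC.exists_isCompact_sdiff_lt (measure_ne_top (p.map e) _) hε6
  obtain ⟨U, hCU, hU, -, hUε⟩ := hC.exists_isOpen_sdiff_lt (measure_ne_top (p.map e) _) hε6
  obtain ⟨d, hd, hdU⟩ := hK.exists_thickening_subset_open hU (hKC.trans hCU)
  have hd' : ENNReal.ofReal d ≠ 0 := by simpa using hd
  rw [Measure.map_apply he.measurable (hC.diff hK.measurableSet)] at hKε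
  rw [Measure.map_apply he.measurable (hU.measurableSet.diff hC)] at hUε
  have hmem : ∀ y, e y ∈ e '' A ↔ y ∈ A := fun y => he.injective.mem_set_image
  -- One half of the symmetric difference.
  have key : ∀ S T : X → X, MeasurePreserving S p p → MeasurePreserving T p p →
      ∫⁻ x, ‖e (S x) - e (T x)‖ₑ ∂p < ENNReal.ofReal d * (ε / 6) →
      p (S ⁻¹' A \ T ⁻¹' A) ≤ ε / 6 + ε / 6 + ε / 6 := by
    intro S T hS hT h
    have hsub : S ⁻¹' A \ T ⁻¹' A ⊆ S ⁻¹' (e ⁻¹' (e '' A \ K)) ∪ T ⁻¹' (e ⁻¹' (U \ e '' A)) ∪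
        {x | ENNReal.ofReal d ≤ ‖e (S x) - e (T x)‖ₑ} := by
      rintro x ⟨hxS, hxT⟩
      by_cases hxK : e (S x) ∈ K
      · by_cases hxU : e (T x) ∈ U
        · exact Or.inl (Or.inr ⟨hxU, fun h => hxT ((hmem _).1 h)⟩)
        · refine Or.inr (?_ : ENNReal.ofReal d ≤ ‖e (S x) - e (T x)‖ₑ)
          by_contra hlt
          refine hxU (hdU (Metric.mem_thickening_iff.2 ⟨e (S x), hxK, ?_⟩))
          rw [not_le, ← ofReal_norm, ENNReal.ofReal_lt_ofReal_iff hd] at hlt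
          rwa [dist_comm, dist_eq_norm]
      · exact Or.inl (Or.inl ⟨(hmem _).2 hxS, hxK⟩)
    have hmark : p {x | ENNReal.ofReal d ≤ ‖e (S x) - e (T x)‖ₑ} ≤ ε / 6 := by
      have hm : Measurable fun x => ‖e (S x) - e (T x)‖ₑ :=
        ((he.measurable.comp hS.measurable).sub (he.measurable.comp hT.measurable)).enorm
      have := (mul_meas_ge_le_lintegral hm (ENNReal.ofReal d)).trans h.le
      exact (ENNReal.mul_le_mul_iff_right hd' ENNReal.ofReal_ne_top).1 this
    refine (measure_mono hsub).trans ((measure_union_le _ _).trans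
      (add_le_add ((measure_union_le _ _).trans (add_le_add ?_ ?_)) hmark))
    · rw [hS.measure_preimage
        (he.measurable (hC.diff hK.measurableSet)).nullMeasurableSet]
      exact hKε.le
    · rw [hT.measure_preimage
        (he.measurable (hU.measurableSet.diff hC)).nullMeasurableSet]
      exact hUε.le
  refine ⟨ENNReal.ofReal d * (ε / 6), ENNReal.mul_pos hd' hε6, fun S T hS hT h => ?_⟩
  have h' : ∫⁻ x, ‖e (T x) - e (S x)‖ₑ ∂p < ENNReal.ofReal d * (ε / 6) := by
    simpa only [enorm_sub_rev] using h
  calc p (symmDiff (S ⁻¹' A) (T ⁻¹' A))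
      ≤ (ε / 6 + ε / 6 + ε / 6) + (ε / 6 + ε / 6 + ε / 6) :=
        (measure_union_le _ _).trans (add_le_add (key S T hS hT h) (key T S hT hS h'))
    _ = 6 * (ε / 6) := by ring
    _ = ε := ENNReal.mul_div_cancel (by simp) (by simp)

/-- The converse estimate: a bounded coordinate is uniformly approximated by its discretizations at
scale `1 / n`. -/
theorem exists_forall_lintegral_enorm_sub_lt (he : Measurable e) (he01 : ∀ x, e x ∈ Icc (0 : ℝ) 1)
    {ε : ℝ≥0∞} (hε : ε ≠ 0) :
    ∃ (n : ℕ) (B : ℕ → Set X) (η : ℝ≥0∞), 0 < η ∧ (∀ k, MeasurableSet (B k)) ∧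
      ∀ S T : X → X, Measurable S → Measurable T →
      (∀ k ≤ n, p (symmDiff (S ⁻¹' B k) (T ⁻¹' B k)) < η) →
      ∫⁻ x, ‖e (S x) - e (T x)‖ₑ ∂p < ε := by
  obtain ⟨ε', hε'0, hε'⟩ := exists_between (pos_iff_ne_zero.2 hε)
  obtain ⟨n, hn0, hn⟩ : ∃ n : ℕ, 0 < n ∧ ENNReal.ofReal (1 / n) < ε' / 2 := by
    have h : Tendsto (fun n : ℕ => ENNReal.ofReal (1 / (n : ℝ))) atTop (𝓝 0) := by
      have := ENNReal.tendsto_ofReal tendsto_one_div_atTop_nhds_zero_nat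
      rwa [ENNReal.ofReal_zero] at this
    obtain ⟨n, h1, h2⟩ := ((eventually_gt_atTop 0).and
      (h.eventually (gt_mem_nhds (ENNReal.half_pos hε'0.ne')))).exists
    exact ⟨n, h1, h2⟩
  have hn0' : (0 : ℝ) < n := by exact_mod_cast hn0
  have hdm : Measurable fun x => ⌊n * e x⌋₊ := Nat.measurable_floor.comp (he.const_mul _)
  refine ⟨n, fun k => (fun x => ⌊n * e x⌋₊) ⁻¹' {k}, ε' / 2 / (n + 1), ?_,
    fun k => hdm (measurableSet_singleton k), fun S T hS hT h => lt_of_le_of_lt ?_ hε'⟩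
  · exact ENNReal.div_pos (ENNReal.half_pos hε'0.ne').ne' (by finiteness)
  set B : ℕ → Set X := fun k => (fun x => ⌊n * e x⌋₊) ⁻¹' {k} with hB
  have hBm : ∀ k, MeasurableSet (B k) := fun k => hdm (measurableSet_singleton k)
  set N : Set X := ⋃ k ∈ Finset.range (n + 1), symmDiff (S ⁻¹' B k) (T ⁻¹' B k) with hN
  have hNm : MeasurableSet N := Finset.measurableSet_biUnion _ fun k _ =>
    (hS (hBm k)).symmDiff (hT (hBm k))
  have hpN : p N ≤ ε' / 2 := by
    calc p N ≤ ∑ k ∈ Finset.range (n + 1), p (symmDiff (S ⁻¹' B k) (T ⁻¹' B k)) :=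
          measure_biUnion_finset_le _ _
      _ ≤ ∑ k ∈ Finset.range (n + 1), ε' / 2 / (n + 1) :=
          Finset.sum_le_sum fun k hk => (h k (by simpa [Nat.lt_succ_iff] using hk)).le
      _ = (n + 1) * (ε' / 2 / (n + 1)) := by simp
      _ = ε' / 2 := ENNReal.mul_div_cancel (by simp) (by finiteness)
  have hpt : ∀ x, ‖e (S x) - e (T x)‖ₑ ≤ ENNReal.ofReal (1 / n) + N.indicator 1 x := by
    intro x
    by_cases hx : x ∈ N
    · rw [indicator_of_mem hx, ← ofReal_norm]
      refine le_add_left ?_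
      rw [Pi.one_apply, ENNReal.ofReal_le_one, Real.norm_eq_abs, abs_le]
      have h1 := he01 (S x)
      have h2 := he01 (T x)
      exact ⟨by linarith [h1.1, h2.2], by linarith [h1.2, h2.1]⟩
    · rw [indicator_of_notMem hx, add_zero, ← ofReal_norm]
      refine ENNReal.ofReal_le_ofReal ?_
      have hfl : ⌊n * e (S x)⌋₊ = ⌊n * e (T x)⌋₊ := by
        have hle : ⌊n * e (S x)⌋₊ ≤ n := by
          refine Nat.floor_le_of_le ?_
          nlinarith [(he01 (S x)).2]
        by_contra hne
        refine hx (mem_biUnion (x := ⌊n * e (S x)⌋₊) ?_ (Or.inl ⟨rfl, fun h => hne h.symm⟩))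
        simpa [Nat.lt_succ_iff] using hle
      have hS0 : 0 ≤ n * e (S x) := mul_nonneg hn0'.le (he01 (S x)).1
      have hT0 : 0 ≤ n * e (T x) := mul_nonneg hn0'.le (he01 (T x)).1
      have h1 := Nat.floor_le hS0
      have h2 := Nat.lt_floor_add_one (n * e (S x))
      have h3 := Nat.floor_le hT0
      have h4 := Nat.lt_floor_add_one (n * e (T x))
      rw [hfl] at h1 h2
      rw [Real.norm_eq_abs, abs_le, ← neg_div, div_le_iff₀ hn0', le_div_iff₀ hn0']
      constructor <;> nlinarith
  calc ∫⁻ x, ‖e (S x) - e (T x)‖ₑ ∂p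
      ≤ ∫⁻ x, ENNReal.ofReal (1 / n) + N.indicator 1 x ∂p := lintegral_mono hpt
    _ = ENNReal.ofReal (1 / n) + p N := by
        rw [lintegral_add_left measurable_const, lintegral_indicator_one hNm]
        simp
    _ ≤ ε' / 2 + ε' / 2 := add_le_add hn.le hpN
    _ = ε' := ENNReal.add_halves ε'

theorem memLp_comp (he : Measurable e) (he01 : ∀ x, e x ∈ Icc (0 : ℝ) 1) {S : X → X}
    (hS : Measurable S) : MemLp (fun x => e (S x)) 1 p :=
  MemLp.of_bound (he.comp hS).aestronglyMeasurable 1 (Eventually.of_forall fun x => by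
    rw [Real.norm_eq_abs, abs_le]
    exact ⟨by linarith [(he01 (S x)).1], (he01 (S x)).2⟩)

/-- The pair `(e ∘ τ, e ∘ τ⁻¹)` as an element of `L¹ × L¹`. -/
noncomputable def coordinates (he : Measurable e) (he01 : ∀ x, e x ∈ Icc (0 : ℝ) 1) (τ : MPMap p) :
    Lp ℝ 1 p × Lp ℝ 1 p :=
  ((memLp_comp he he01 τ.toEquiv.measurable).toLp,
    (memLp_comp he he01 τ.toEquiv.symm.measurable).toLp)

theorem edist_toLp_comp (he : Measurable e) (he01 : ∀ x, e x ∈ Icc (0 : ℝ) 1) {S T : X → X}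
    (hS : Measurable S) (hT : Measurable T) :
    edist ((memLp_comp (p := p) he he01 hS).toLp) ((memLp_comp (p := p) he he01 hT).toLp) =
      ∫⁻ x, ‖e (S x) - e (T x)‖ₑ ∂p := by
  rw [Lp.edist_toLp_toLp, eLpNorm_one_eq_lintegral_enorm]
  rfl

theorem isInducing_coordinates (he : MeasurableEmbedding e) (he01 : ∀ x, e x ∈ Icc (0 : ℝ) 1) :
    IsInducing (coordinates (p := p) he.measurable he01) := by
  rw [isInducing_iff_nhds]
  intro τ₀
  apply le_antisymm
  · rw [← tendsto_iff_comap, coordinates, nhds_prod_eq]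
    refine Tendsto.prodMk ?_ ?_
    · rw [EMetric.tendsto_nhds]
      intro ε hε
      obtain ⟨n, B, η, hη, hB, h⟩ := exists_forall_lintegral_enorm_sub_lt (p := p)
        he.measurable he01 hε.ne'
      have hnhds : ∀ᶠ τ : MPMap p in 𝓝 τ₀, ∀ k ∈ Iic n, τ ∈ weakBall τ₀ (τ₀ ⁻¹' B k) η :=
        (finite_Iic n).eventually_all.2 fun k _ =>
          weakBall_mem_nhds τ₀ (τ₀.toEquiv.measurable (hB k)) hη
      filter_upwards [hnhds] with τ hτ
      rw [edist_toLp_comp he.measurable he01 τ.toEquiv.measurable τ₀.toEquiv.measurable]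
      refine h _ _ τ.toEquiv.measurable τ₀.toEquiv.measurable fun k hk => ?_
      rw [measure_symmDiff_preimage]
      exact hτ k hk
    · rw [EMetric.tendsto_nhds]
      intro ε hε
      obtain ⟨n, B, η, hη, hB, h⟩ := exists_forall_lintegral_enorm_sub_lt (p := p)
        he.measurable he01 hε.ne'
      have hnhds : ∀ᶠ τ : MPMap p in 𝓝 τ₀, ∀ k ∈ Iic n, τ ∈ weakBall τ₀ (B k) η :=
        (finite_Iic n).eventually_all.2 fun k _ => weakBall_mem_nhds τ₀ (hB k) hη
      filter_upwards [hnhds] with τ hτ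
      rw [edist_toLp_comp he.measurable he01 τ.toEquiv.symm.measurable
        τ₀.toEquiv.symm.measurable]
      refine h _ _ τ.toEquiv.symm.measurable τ₀.toEquiv.symm.measurable fun k hk => ?_
      rw [← image_eq_preimage_symm, ← image_eq_preimage_symm]
      exact hτ k hk
  · refine le_of_le_of_eq ?_ TopologicalSpace.nhds_generateFrom.symm
    refine le_iInf₂ fun s hs => ?_
    obtain ⟨hτ₀, τ₁, A, ε, hA, hε, rfl⟩ := hs
    rw [le_principal_iff]
    obtain ⟨c, hc, hcε⟩ := exists_weakBall_subset hτ₀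
    obtain ⟨c', hc', hc'c⟩ := exists_between hc
    obtain ⟨δ, hδ, h⟩ := exists_forall_measure_symmDiff_le (p := p) he hA hc'.ne'
    refine ⟨{y | edist y.2 (coordinates he.measurable he01 τ₀).2 < δ}, ?_, fun τ hτ => ?_⟩
    · exact (continuous_snd.edist continuous_const).isOpen_preimage _ isOpen_Iio |>.mem_nhds
        (by simpa using hδ)
    · have hτ' : edist (coordinates he.measurable he01 τ).2
        (coordinates he.measurable he01 τ₀).2 < δ := hτ
      rw [coordinates, coordinates, edist_toLp_comp he.measurable he01 τ.toEquiv.symm.measurable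
        τ₀.toEquiv.symm.measurable] at hτ'
      have := h _ _ τ.measurePreserving_symm τ₀.measurePreserving_symm hτ'
      simp only [← image_eq_preimage_symm] at this
      exact hcε (lt_of_le_of_lt this hc'c)

/-- An `L¹`-limit of coordinates `e ∘ S k` of measure-preserving maps is the coordinate of a
measure-preserving map: the limit has the law of `e`, hence takes its values in the range of `e`. -/
theorem exists_measurePreserving_of_tendstoInMeasure (he : MeasurableEmbedding e)
    {S : ℕ → X → X} (hS : ∀ k, MeasurePreserving (S k) p p) {u : X → ℝ}
    (hu : AEStronglyMeasurable u p)
    (hlim : TendstoInMeasure p (fun k x => e (S k x)) atTop u) :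
    ∃ T : X → X, MeasurePreserving T p p ∧ (fun x => e (T x)) =ᵐ[p] u := by
  have : Nonempty X := nonempty_of_isProbabilityMeasure p
  set v := hu.mk u with hv
  have hvm : Measurable v := hu.measurable_mk
  obtain ⟨ns, -, hns⟩ := hlim.exists_seq_tendsto_ae
  have : IsProbabilityMeasure (p.map e) :=
    Measure.isProbabilityMeasure_map he.measurable.aemeasurable
  have : IsProbabilityMeasure (p.map v) := Measure.isProbabilityMeasure_map hvm.aemeasurable
  have hlaw : p.map v = p.map e := by
    refine ext_of_forall_integral_eq_of_IsFiniteMeasure fun w => ?_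
    rw [integral_map hvm.aemeasurable w.continuous.aestronglyMeasurable,
      integral_map he.measurable.aemeasurable w.continuous.aestronglyMeasurable]
    have h1 : Tendsto (fun k => ∫ x, w (e (S (ns k) x)) ∂p) atTop (𝓝 (∫ x, w (v x) ∂p)) := by
      refine tendsto_integral_of_dominated_convergence (fun _ => ‖w‖)
        (fun k => (w.continuous.measurable.comp
          (he.measurable.comp (hS _).measurable)).aestronglyMeasurable)
        (integrable_const _) (fun k => Eventually.of_forall fun x => w.norm_coe_le_norm _) ?_
      filter_upwards [hns, hu.ae_eq_mk] with x h2 h3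
      rw [h3] at h2
      exact (w.continuous.tendsto _).comp h2
    have h2 : ∀ k, ∫ x, w (e (S (ns k) x)) ∂p = ∫ x, w (e x) ∂p := fun k => by
      have hm : AEStronglyMeasurable (fun x => w (e x)) (p.map (S (ns k))) :=
        (w.continuous.measurable.comp he.measurable).aestronglyMeasurable
      have := integral_map (hS (ns k)).aemeasurable hm
      rw [(hS (ns k)).map_eq] at this
      exact this.symm
    simp only [h2] at h1
    exact tendsto_nhds_unique tendsto_const_nhds h1 |>.symm
  have hrange : ∀ᵐ x ∂p, v x ∈ range e := by
    refine ae_of_ae_map (p := fun y => y ∈ range e) hvm.aemeasurable ?_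
    rw [hlaw]
    exact (ae_map_iff he.measurable.aemeasurable he.measurableSet_range).2
      (Eventually.of_forall mem_range_self)
  refine ⟨fun x => he.invFun (v x), ⟨he.measurable_invFun.comp hvm, ?_⟩, ?_⟩
  · change p.map (he.invFun ∘ v) = p
    rw [← Measure.map_map he.measurable_invFun hvm, hlaw,
      Measure.map_map he.measurable_invFun he.measurable, he.leftInverse_invFun.id, Measure.map_id]
  · filter_upwards [hrange, hu.ae_eq_mk] with x h1 h2
    obtain ⟨y, hy⟩ := h1
    rw [h2, ← hv, ← hy, he.leftInverse_invFun y]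

theorem tendsto_measure_symmDiff_preimage (he : MeasurableEmbedding e)
    {S : ℕ → X → X} (hS : ∀ k, MeasurePreserving (S k) p p) {T : X → X}
    (hT : MeasurePreserving T p p)
    (h : Tendsto (fun k => ∫⁻ x, ‖e (S k x) - e (T x)‖ₑ ∂p) atTop (𝓝 0)) {A : Set X}
    (hA : MeasurableSet A) :
    Tendsto (fun k => p (symmDiff (S k ⁻¹' A) (T ⁻¹' A))) atTop (𝓝 0) := by
  rw [ENNReal.tendsto_nhds_zero]
  intro ε hε
  obtain ⟨δ, hδ, H⟩ := exists_forall_measure_symmDiff_le (p := p) he hA hε.ne'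
  filter_upwards [h.eventually (gt_mem_nhds hδ)] with k hk using H _ _ (hS k) hT hk

theorem isClosed_range_coordinates [StandardBorelSpace X] (he : MeasurableEmbedding e)
    (he01 : ∀ x, e x ∈ Icc (0 : ℝ) 1) :
    IsClosed (range (coordinates (p := p) he.measurable he01)) := by
  rw [← isSeqClosed_iff_isClosed]
  intro y z hy hyz
  choose τ hτ using hy
  obtain rfl : (fun k => coordinates he.measurable he01 (τ k)) = y := funext hτ
  have hpre : ∀ (S : ℕ → X → X) (hS : ∀ k, MeasurePreserving (S k) p p) (u : Lp ℝ 1 p),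
      Tendsto (fun k => (memLp_comp (p := p) he.measurable he01 (hS k).measurable).toLp) atTop
        (𝓝 u) →
      ∃ (T : X → X) (hT : MeasurePreserving T p p),
        (memLp_comp (p := p) he.measurable he01 hT.measurable).toLp = u ∧
        ∀ A, MeasurableSet A → Tendsto (fun k => p (symmDiff (S k ⁻¹' A) (T ⁻¹' A))) atTop
          (𝓝 0) := by
    intro S hS u hu
    have hmeas : TendstoInMeasure p (fun k x => e (S k x)) atTop u :=
      (tendstoInMeasure_of_tendsto_Lp hu).congr_left fun k => MemLp.coeFn_toLp _
    obtain ⟨T, hT, hTu⟩ := exists_measurePreserving_of_tendstoInMeasure he hS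
      (Lp.aestronglyMeasurable u) hmeas
    have hTu' : (memLp_comp (p := p) he.measurable he01 hT.measurable).toLp = u :=
      Lp.ext ((MemLp.coeFn_toLp _).trans hTu)
    refine ⟨T, hT, hTu', fun A hA => tendsto_measure_symmDiff_preimage he hS hT ?_ hA⟩
    rw [← hTu', tendsto_iff_edist_tendsto_0] at hu
    simpa only [edist_toLp_comp he.measurable he01 (hS _).measurable hT.measurable] using hu
  obtain ⟨S, hS, hSz, hSlim⟩ := hpre (fun k => τ k) (fun k => (τ k).measurePreserving) z.1
    ((continuous_fst.tendsto z).comp hyz)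
  obtain ⟨T, hT, hTz, hTlim⟩ := hpre (fun k => (τ k).toEquiv.symm)
    (fun k => (τ k).measurePreserving_symm) z.2 ((continuous_snd.tendsto z).comp hyz)
  -- In the measure algebra, `S⁻¹ (T⁻¹ B)` is the limit of `(τ k)⁻¹ (τ k B) = B`.
  have hinv : ∀ᵐ x ∂p, T (S x) = x := by
    refine Filter.EventuallyEq.of_forall_separating_preimage (f := fun x => T (S x)) (g := id)
      MeasurableSet fun B hB => ?_
    rw [← measure_symmDiff_eq_zero_iff]
    have hlim := (hSlim (T ⁻¹' B) (hT.measurable hB)).add (hTlim B hB)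
    rw [add_zero] at hlim
    refine le_antisymm (ge_of_tendsto' hlim fun k => ?_) bot_le
    have hB' : id ⁻¹' B = τ k ⁻¹' ((τ k).toEquiv.symm ⁻¹' B) := by
      ext x; simp
    have e2 : p (symmDiff ((τ k).toEquiv.symm ⁻¹' B) (T ⁻¹' B)) =
        p (symmDiff (τ k ⁻¹' (T ⁻¹' B)) (id ⁻¹' B)) := by
      rw [hB', ← preimage_symmDiff, measure_preimage, symmDiff_comm]
    rw [e2, symmDiff_comm (τ k ⁻¹' (T ⁻¹' B))]
    exact measure_symmDiff_le _ _ _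
  obtain ⟨σ, hσS, hσT⟩ := exists_ae_eq_of_ae_leftInverse hS hT hinv
  refine ⟨σ, Prod.ext ?_ ?_⟩
  · rw [← hSz, coordinates]
    exact (MemLp.toLp_eq_toLp_iff (memLp_comp he.measurable he01 σ.toEquiv.measurable) _).2
      (by filter_upwards [hσS] with x hx; rw [hx])
  · rw [← hTz, coordinates]
    exact (MemLp.toLp_eq_toLp_iff (memLp_comp he.measurable he01 σ.toEquiv.symm.measurable) _).2
      (by filter_upwards [hσT] with x hx; rw [hx])

/-- The maps of a standard Borel probability space, with the weak topology, form a completely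
pseudometrizable space. -/
instance isCompletelyPseudoMetrizableSpace [StandardBorelSpace X] :
    TopologicalSpace.IsCompletelyPseudoMetrizableSpace (MPMap p) := by
  have he : MeasurableEmbedding fun x : X => (unitInterval.sigmoid (embeddingReal X x) : ℝ) :=
    (MeasurableEmbedding.subtype_coe measurableSet_Icc).comp
      (measurableEmbedding_sigmoid_comp_embeddingReal X)
  have he01 : ∀ x : X, (unitInterval.sigmoid (embeddingReal X x) : ℝ) ∈ Icc (0 : ℝ) 1 :=
    fun x => (unitInterval.sigmoid (embeddingReal X x)).2
  have hJ := isInducing_coordinates (p := p) he he01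
  let _ : PseudoMetricSpace (MPMap p) := hJ.comapPseudoMetricSpace
  have : CompleteSpace (MPMap p) :=
    (completeSpace_iff_isComplete_range (f := coordinates he.measurable he01) ⟨rfl⟩).2
      (isClosed_range_coordinates he he01).isComplete
  infer_instance

end Complete

/-! ### Density of pairs for which an indicator splits -/

section Density

variable {X : Type*} [MeasurableSpace X] {p : Measure X}

/-- The part of `φ` left over after removing the indicator of `A`. -/
noncomputable def remainder (A : Set X) (φ : X → ℤ) (x : X) : ℤ := φ x - A.indicator 1 x

theorem measurable_remainder {A : Set X} (hA : MeasurableSet A) {φ : X → ℤ} (hφ : Measurable φ) :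
    Measurable (remainder A φ) :=
  hφ.sub (measurable_one.indicator hA)

/-- The pairs `(σ, τ)` for which the indicator of `A` is the difference of an almost `σ`-invariant
function and an almost `τ`-invariant function, the former with values in `{0, …, L - 1}`; invariance
is measured by `η`. -/
def almostSplit (p : Measure X) (A : Set X) (L : ℕ) (η : ℝ≥0∞) : Set (MPMap p × MPMap p) :=
  {π | ∃ φ : X → ℤ, Measurable φ ∧ (∀ x, φ x ∈ Ico (0 : ℤ) L) ∧
    (∀ k ∈ Ico (-1 : ℤ) L, p (symmDiff (π.1 '' (φ ⁻¹' {k})) (φ ⁻¹' {k})) < η) ∧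
    ∀ k ∈ Ico (-1 : ℤ) L,
      p (symmDiff (π.2 '' (remainder A φ ⁻¹' {k})) (remainder A φ ⁻¹' {k})) < η}

theorem isOpen_almostSplit {A : Set X} (hA : MeasurableSet A) (L : ℕ) {η : ℝ≥0∞} (hη : 0 < η) :
    IsOpen (almostSplit p A L η) := by
  have hball : ∀ B : Set X, MeasurableSet B →
      IsOpen {τ : MPMap p | p (symmDiff (τ '' B) B) < η} := fun B hB => by
    have := isOpen_weakBall (p := p) ⟨MeasurableEquiv.refl X, MeasurePreserving.id p⟩ hB hη
    simpa [weakBall] using this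
  rw [isOpen_iff_mem_nhds]
  rintro ⟨σ, τ⟩ ⟨φ, hφ, hL, h1, h2⟩
  have e1 : ∀ᶠ π : MPMap p × MPMap p in 𝓝 (σ, τ), ∀ k ∈ Ico (-1 : ℤ) L,
      p (symmDiff (π.1 '' (φ ⁻¹' {k})) (φ ⁻¹' {k})) < η :=
    (finite_Ico _ _).eventually_all.2 fun k hk =>
      ((hball _ (hφ (measurableSet_singleton k))).preimage continuous_fst).mem_nhds (h1 k hk)
  have e2 : ∀ᶠ π : MPMap p × MPMap p in 𝓝 (σ, τ), ∀ k ∈ Ico (-1 : ℤ) L,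
      p (symmDiff (π.2 '' (remainder A φ ⁻¹' {k})) (remainder A φ ⁻¹' {k})) < η :=
    (finite_Ico _ _).eventually_all.2 fun k hk =>
      ((hball _ (measurable_remainder hA hφ (measurableSet_singleton k))).preimage
        continuous_snd).mem_nhds (h2 k hk)
  filter_upwards [e1, e2] with π h1 h2 using ⟨φ, hφ, hL, h1, h2⟩

theorem measure_symmDiff_image_preimage_eq_zero {ι : Type*} (τ : MPMap p) {g : X → ι}
    (hg : ∀ᵐ x ∂p, g (τ x) = g x) (s : Set ι) :
    p (symmDiff (τ '' (g ⁻¹' s)) (g ⁻¹' s)) = 0 := by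
  rw [measure_symmDiff_image_left, measure_symmDiff_eq_zero_iff, ← preimage_comp]
  filter_upwards [hg] with x hx
  exact propext (show g x ∈ s ↔ g (τ x) ∈ s by rw [hx])

variable [StandardBorelSpace X] [IsProbabilityMeasure p] [NullSingletonClass p]

/-- Some function is uniformly distributed on `{0, …, L - 1}` and independent of a given countable
labelling. -/
theorem exists_independent_digit {ι : Type*} [MeasurableSpace ι] [Countable ι]
    [MeasurableSingletonClass ι] {α : X → ι} (hα : Measurable α) {L : ℕ} (hL : 0 < L) :
    ∃ φ : X → ℤ, Measurable φ ∧ (∀ x, φ x ∈ Ico (0 : ℤ) L) ∧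
      ∀ (s : Set ι), ∀ k ∈ Ico (0 : ℤ) L,
        p (α ⁻¹' s ∩ φ ⁻¹' {k}) = p (α ⁻¹' s) * (L : ℝ≥0∞)⁻¹ := by
  classical
  obtain ⟨F, -, hF, hl, -⟩ := exists_independent_uniform p hα
  have hL' : (0 : ℝ) < L := by exact_mod_cast hL
  set d : ℝ → ℤ := fun y => if y ∈ Ico (0 : ℝ) 1 then ⌊L * y⌋ else 0 with hd
  have hdm : Measurable d :=
    Measurable.ite measurableSet_Ico (Int.measurable_floor.comp (measurable_id.const_mul _))
      measurable_const
  refine ⟨fun x => d (F x), hdm.comp hF, fun x => ?_, fun s k hk => ?_⟩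
  · simp only [hd]
    split_ifs with h
    · refine ⟨Int.floor_nonneg.2 (mul_nonneg hL'.le h.1), Int.floor_lt.2 ?_⟩
      push_cast
      nlinarith [h.2]
    · exact ⟨le_rfl, by exact_mod_cast hL⟩
  · have hs : MeasurableSet s := s.to_countable.measurableSet
    have hk' : MeasurableSet (d ⁻¹' {k}) := hdm (measurableSet_singleton k)
    have h1 : p (α ⁻¹' s ∩ (fun x => d (F x)) ⁻¹' {k}) =
        p.map (fun x => (α x, F x)) (s ×ˢ (d ⁻¹' {k})) := by
      rw [Measure.map_apply (hα.prodMk hF) (hs.prod hk')]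
      rfl
    rw [h1, hl, Measure.prod_prod, Measure.map_apply hα hs]
    congr 1
    rw [Measure.restrict_congr_set Ico_ae_eq_Icc.symm, Measure.restrict_apply hk']
    have h2 : d ⁻¹' {k} ∩ Ico 0 1 = Ico ((k : ℝ) / L) ((k + 1) / L) := by
      have h0 : (0 : ℝ) ≤ k := by exact_mod_cast hk.1
      have h3 : (k : ℝ) + 1 ≤ L := by exact_mod_cast hk.2
      ext y
      simp only [mem_inter_iff, mem_preimage, mem_singleton_iff, mem_Ico, div_le_iff₀ hL',
        lt_div_iff₀ hL', hd]
      constructor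
      · rintro ⟨h, h4⟩
        rw [if_pos h4, Int.floor_eq_iff] at h
        exact ⟨by linarith [h.1], by linarith [h.2]⟩
      · rintro ⟨h4, h5⟩
        have h6 : 0 ≤ y ∧ y < 1 := ⟨by nlinarith, by nlinarith⟩
        refine ⟨?_, h6⟩
        rw [if_pos h6, Int.floor_eq_iff]
        exact ⟨by linarith, by linarith⟩
    rw [h2, Real.volume_Ico, ← sub_div, add_sub_cancel_left, one_div,
      ENNReal.ofReal_inv_of_pos hL', ENNReal.ofReal_natCast]

/-- The combinatorial core. Cells are the fibres of the finite labelling `P`. The digit `φ` is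
uniform and independent of the cells, so it can be preserved exactly while cells are moved as `σ₁`
does. So is `φ - 1_A`, off its two extreme values: translating a uniform law on `{0, …, L - 1}` by
one changes it only at the end points. -/
theorem exists_invariant_split {K : Type*} [MeasurableSpace K] [Countable K]
    [MeasurableSingletonClass K] {P : X → K} (hP : Measurable P) {A : Set X} (hA : MeasurableSet A)
    (σ₁ τ₁ : MPMap p) {L : ℕ} (hL : 0 < L) :
    ∃ (φ : X → ℤ) (σ τ : MPMap p), Measurable φ ∧ (∀ x, φ x ∈ Ico (0 : ℤ) L) ∧
      (∀ᵐ x ∂p, φ (σ x) = φ x) ∧ (∀ᵐ x ∂p, remainder A φ (τ x) = remainder A φ x) ∧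
      (∀ᵐ x ∂p, P (σ₁.toEquiv.symm (σ x)) = P x) ∧
      p {x | P (τ₁.toEquiv.symm (τ x)) ≠ P x} ≤ (L : ℝ≥0∞)⁻¹ := by
  classical
  have hPσ : Measurable fun x => P (σ₁.toEquiv.symm x) := hP.comp σ₁.toEquiv.symm.measurable
  have hPτ : Measurable fun x => P (τ₁.toEquiv.symm x) := hP.comp τ₁.toEquiv.symm.measurable
  have hAm : Measurable fun x => decide (x ∈ A) :=
    measurable_to_bool (by simpa [preimage] using hA)
  obtain ⟨φ, hφ, hφL, hind⟩ := exists_independent_digit (p := p)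
    (hP.prodMk (hPσ.prodMk (hPτ.prodMk hAm))) hL
  set ψ := remainder A φ with hψ
  have hψm : Measurable ψ := measurable_remainder hA hφ
  -- Independence of `φ` from a cell, a translated cell, and their intersections with `A`.
  have hindA : ∀ (R : X → K), (R = P ∨ R = (fun x => P (σ₁.toEquiv.symm x)) ∨
      R = fun x => P (τ₁.toEquiv.symm x)) → ∀ (c : Set K) (b : Set Bool), ∀ k ∈ Ico (0 : ℤ) L,
      p ((R ⁻¹' c ∩ (fun x => decide (x ∈ A)) ⁻¹' b) ∩ φ ⁻¹' {k}) =
        p (R ⁻¹' c ∩ (fun x => decide (x ∈ A)) ⁻¹' b) * (L : ℝ≥0∞)⁻¹ := by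
    rintro R (rfl | rfl | rfl) c b k hk
    · exact hind {y | y.1 ∈ c ∧ y.2.2.2 ∈ b} k hk
    · exact hind {y | y.2.1 ∈ c ∧ y.2.2.2 ∈ b} k hk
    · exact hind {y | y.2.2.1 ∈ c ∧ y.2.2.2 ∈ b} k hk
  have hT : (fun x => decide (x ∈ A)) ⁻¹' {true} = A := by ext x; simp
  have hF : (fun x => decide (x ∈ A)) ⁻¹' {false} = Aᶜ := by ext x; simp
  have hindφ : ∀ (R : X → K), (R = P ∨ R = (fun x => P (σ₁.toEquiv.symm x)) ∨
      R = fun x => P (τ₁.toEquiv.symm x)) → ∀ c : Set K, ∀ k ∈ Ico (0 : ℤ) L,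
      p (R ⁻¹' c ∩ φ ⁻¹' {k}) = p (R ⁻¹' c) * (L : ℝ≥0∞)⁻¹ := fun R hR c k hk => by
    simpa only [preimage_univ, inter_univ] using hindA R hR c univ k hk
  have hψlevel : ∀ k, ψ ⁻¹' {k} = (A ∩ φ ⁻¹' {k + 1}) ∪ (Aᶜ ∩ φ ⁻¹' {k}) := fun k => by
    ext x
    by_cases hx : x ∈ A
    · simp only [hψ, remainder, mem_preimage, mem_singleton_iff, mem_union, mem_inter_iff,
        mem_compl_iff, hx, indicator_of_mem, Pi.one_apply, true_and, not_true, false_and, or_false]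
      omega
    · simp [hψ, remainder, hx]
  have hindψ : ∀ (R : X → K), Measurable R → (R = P ∨ R = (fun x => P (σ₁.toEquiv.symm x)) ∨
      R = fun x => P (τ₁.toEquiv.symm x)) → ∀ c : K, ∀ k ∈ Ico (0 : ℤ) (L - 1),
      p (R ⁻¹' {c} ∩ ψ ⁻¹' {k}) = p (R ⁻¹' {c}) * (L : ℝ≥0∞)⁻¹ := fun R hRm hR c k hk => by
    have h1 := hindA R hR {c} {true} (k + 1) ⟨by linarith [hk.1], by linarith [hk.2]⟩
    have h2 := hindA R hR {c} {false} k ⟨hk.1, by linarith [hk.2]⟩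
    rw [hT] at h1
    rw [hF] at h2
    rw [hψlevel, inter_union_distrib_left, ← inter_assoc, ← inter_assoc, measure_union _ _, h1, h2,
      ← add_mul, ← measure_inter_add_sdiff (R ⁻¹' {c}) hA, Set.sdiff_eq]
    · refine Disjoint.mono (inter_subset_left.trans inter_subset_right)
        (inter_subset_left.trans inter_subset_right) disjoint_compl_right
    · exact ((hRm (measurableSet_singleton c)).inter hA.compl).inter
        (hφ (measurableSet_singleton k))
  have hcell : ∀ (ν : MPMap p) (c : K), p ((fun x => P (ν.toEquiv.symm x)) ⁻¹' {c}) =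
      p (P ⁻¹' {c}) := fun ν c =>
    ν.measurePreserving_symm.measure_preimage (hP (measurableSet_singleton c)).nullMeasurableSet
  -- `σ` carries the labels `(P, φ)` to `(P ∘ σ₁⁻¹, φ)`.
  obtain ⟨σ, hσ⟩ := exists_mpMap_of_map_eq p (hP.prodMk hφ) (hPσ.prodMk hφ) (by
    refine Measure.ext_of_singleton fun ⟨c, k⟩ => ?_
    rw [Measure.map_apply (hP.prodMk hφ) (measurableSet_singleton _),
      Measure.map_apply (hPσ.prodMk hφ) (measurableSet_singleton _), ← singleton_prod_singleton,
      mk_preimage_prod, mk_preimage_prod]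
    by_cases hk : k ∈ Ico (0 : ℤ) L
    · rw [hindφ _ (Or.inl rfl) _ k hk, hindφ _ (Or.inr (Or.inl rfl)) _ k hk, hcell]
    · have : φ ⁻¹' {k} = ∅ := by
        ext x
        simp only [mem_preimage, mem_singleton_iff, mem_empty_iff_false, iff_false]
        rintro rfl
        exact hk (hφL x)
      simp [this])
  -- `τ` carries `(P, ψ)` to `(P ∘ τ₁⁻¹, ψ)`, the cell being forgotten at the extreme values of `ψ`.
  obtain ⟨x₀⟩ := nonempty_of_isProbabilityMeasure p
  set lab : (X → K) → X → K × ℤ := fun R x =>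
    (if ψ x ∈ Ico (0 : ℤ) (L - 1) then R x else P x₀, ψ x) with hlab
  have hgood : MeasurableSet {x | ψ x ∈ Ico (0 : ℤ) (L - 1)} := hψm measurableSet_Ico
  have hlabm : ∀ R : X → K, Measurable R → Measurable (lab R) := fun R hR =>
    (Measurable.ite hgood hR measurable_const).prodMk hψm
  obtain ⟨τ, hτ⟩ := exists_mpMap_of_map_eq p (hlabm _ hP) (hlabm _ hPτ) (by
    refine Measure.ext_of_singleton fun ⟨c, k⟩ => ?_
    rw [Measure.map_apply (hlabm _ hP) (measurableSet_singleton _),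
      Measure.map_apply (hlabm _ hPτ) (measurableSet_singleton _)]
    by_cases hk : k ∈ Ico (0 : ℤ) (L - 1)
    · have h : ∀ R : X → K, lab R ⁻¹' {(c, k)} = R ⁻¹' {c} ∩ ψ ⁻¹' {k} := fun R => by
        ext x
        simp only [hlab, mem_preimage, mem_singleton_iff, Prod.mk.injEq, mem_inter_iff]
        refine and_congr_left fun hx => ?_
        rw [hx, if_pos hk]
      rw [h, h, hindψ P hP (Or.inl rfl) c k hk, hindψ _ hPτ (Or.inr (Or.inr rfl)) c k hk, hcell]
    · have h : ∀ R : X → K, lab R ⁻¹' {(c, k)} = {x | P x₀ = c} ∩ ψ ⁻¹' {k} := fun R => by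
        ext x
        simp only [hlab, mem_preimage, mem_singleton_iff, Prod.mk.injEq, mem_inter_iff, mem_ofPred_eq]
        refine and_congr_left fun hx => ?_
        rw [hx, if_neg hk]
      rw [h, h])
  refine ⟨φ, σ, τ, hφ, hφL, ?_, ?_, ?_, ?_⟩
  · filter_upwards [hσ] with x hx using congrArg Prod.snd hx
  · filter_upwards [hτ] with x hx using congrArg Prod.snd hx
  · filter_upwards [hσ] with x hx using congrArg Prod.fst hx
  · have hsub : {x | P (τ₁.toEquiv.symm (τ x)) ≠ P x} ≤ᵐ[p]
        (A ∩ φ ⁻¹' {0} ∪ Aᶜ ∩ φ ⁻¹' {(L : ℤ) - 1} : Set X) := by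
      filter_upwards [hτ] with x hx hne
      have h2 : ψ (τ x) = ψ x := congrArg Prod.snd hx
      have h1 : (if ψ (τ x) ∈ Ico (0 : ℤ) (L - 1) then P (τ₁.toEquiv.symm (τ x)) else P x₀) =
        if ψ x ∈ Ico (0 : ℤ) (L - 1) then P x else P x₀ := congrArg Prod.fst hx
      have hbad : ψ x ∉ Ico (0 : ℤ) (L - 1) := fun hg => by
        rw [h2, if_pos hg, if_pos hg] at h1
        exact hne h1
      have hφx := hφL x
      by_cases hxA : x ∈ A
      · refine Or.inl ⟨hxA, ?_⟩
        simp only [hψ, remainder, hxA, indicator_of_mem, Pi.one_apply, mem_Ico] at hbad hφx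
        simp only [mem_preimage, mem_singleton_iff]
        omega
      · refine Or.inr ⟨hxA, ?_⟩
        simp only [hψ, remainder, hxA, indicator_of_notMem, not_false_eq_true, sub_zero,
          mem_Ico] at hbad hφx
        simp only [mem_preimage, mem_singleton_iff]
        omega
    have h1 := hindA P (Or.inl rfl) univ {true} 0 ⟨le_rfl, by exact_mod_cast hL⟩
    have h2 := hindA P (Or.inl rfl) univ {false} (L - 1) ⟨by omega, by omega⟩
    rw [hT, preimage_univ, univ_inter] at h1
    rw [hF, preimage_univ, univ_inter] at h2
    refine (measure_mono_ae hsub).trans ((measure_union_le _ _).trans ?_)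
    rw [h1, h2, ← add_mul, prob_add_prob_compl hA, one_mul]

/-- Every pair of maps is weakly approximated by pairs for which the indicator of `A` splits. -/
theorem dense_iUnion_almostSplit {A : Set X} (hA : MeasurableSet A) {η : ℕ → ℝ≥0∞}
    (hη : ∀ L, 0 < η L) : Dense (⋃ L, almostSplit p A L (η L)) := by
  classical
  rintro ⟨σ₁, τ₁⟩
  rw [mem_closure_iff_nhds]
  intro V hV
  obtain ⟨V₁, hV₁, V₂, hV₂, hVV⟩ := mem_nhds_prod_iff.1 hV
  obtain ⟨𝓑₁, ε₁, hf₁, hm₁, hε₁, h₁⟩ := exists_finite_forall_mem_of_mem_nhds hV₁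
  obtain ⟨𝓑₂, ε₂, hf₂, hm₂, hε₂, h₂⟩ := exists_finite_forall_mem_of_mem_nhds hV₂
  have : Finite (𝓑₁ ∪ 𝓑₂ : Set (Set X)) := (hf₁.union hf₂).to_subtype
  have hm : ∀ B : (𝓑₁ ∪ 𝓑₂ : Set (Set X)), MeasurableSet B.1 := fun B => B.2.elim (hm₁ _) (hm₂ _)
  set P : X → ((𝓑₁ ∪ 𝓑₂ : Set (Set X)) → Bool) := fun x B => decide (x ∈ B.1) with hP
  have hPm : Measurable P := measurable_pi_lambda _ fun B =>
    measurable_to_bool (by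
      have : (fun x => P x B) ⁻¹' {true} = B.1 := by ext x; simp [hP]
      rw [this]
      exact hm B)
  have hPB : ∀ B (hB : B ∈ (𝓑₁ ∪ 𝓑₂ : Set (Set X))) x y, P x = P y → (x ∈ B ↔ y ∈ B) := by
    intro B hB x y hxy
    simpa [hP] using congrFun hxy ⟨B, hB⟩
  obtain ⟨L, hL, hLε⟩ : ∃ L : ℕ, 0 < L ∧ (L : ℝ≥0∞)⁻¹ < ε₂ :=
    ((eventually_gt_atTop 0).and
      (ENNReal.tendsto_inv_nat_nhds_zero.eventually (gt_mem_nhds hε₂))).exists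
  obtain ⟨φ, σ, τ, hφ, hφL, hφσ, hφτ, hσ, hτ⟩ := exists_invariant_split hPm hA σ₁ τ₁ hL
  -- Pulled back by `ν`, the set `ν B ∆ ν₁ B` consists of the `x` that `B` separates from `ν₁⁻¹ (ν x)`.
  have hsymm : ∀ (ν ν₁ : MPMap p) (B : Set X), p (symmDiff (ν '' B) (ν₁ '' B)) =
      p {x | ¬ (ν₁.toEquiv.symm (ν x) ∈ B ↔ x ∈ B)} := fun ν ν₁ B => by
    rw [measure_symmDiff_image_left, image_eq_preimage_symm]
    congr 1
    ext x
    simp only [mem_symmDiff, mem_preimage, mem_ofPred_eq]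
    tauto
  refine ⟨(σ, τ), hVV ⟨h₁ σ fun B hB => ?_, h₂ τ fun B hB => ?_⟩, mem_iUnion.2 ⟨L, φ, hφ, hφL,
    fun k _ => ?_, fun k _ => ?_⟩⟩
  · rw [hsymm]
    refine lt_of_eq_of_lt ?_ hε₁
    change ∀ᵐ x ∂p, _
    filter_upwards [hσ] with x hx
    exact hPB B (Or.inl hB) _ _ hx
  · rw [hsymm]
    refine (measure_mono ?_).trans_lt (hτ.trans_lt hLε)
    exact fun x hx hxP => hx (hPB B (Or.inr hB) _ _ hxP)
  · rw [measure_symmDiff_image_preimage_eq_zero σ hφσ]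
    exact hη L
  · rw [measure_symmDiff_image_preimage_eq_zero τ hφτ]
    exact hη L

end Density

/-! ### Cutoffs along the orbit graph -/

section Cutoff

variable {X : Type*} [MeasurableSpace X] {p : Measure X}

/-- The points at distance at most `n` from `E` in the graph in which `x` is joined to `σ x` and
`τ x`. -/
def orbitThickening (σ τ : MPMap p) (E : Set X) : ℕ → Set X
  | 0 => E
  | n + 1 => orbitThickening σ τ E n ∪
      ((σ '' orbitThickening σ τ E n ∪ σ ⁻¹' orbitThickening σ τ E n) ∪
        (τ '' orbitThickening σ τ E n ∪ τ ⁻¹' orbitThickening σ τ E n))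

theorem measurableSet_orbitThickening (σ τ : MPMap p) {E : Set X} (hE : MeasurableSet E) (n : ℕ) :
    MeasurableSet (orbitThickening σ τ E n) := by
  induction n with
  | zero => exact hE
  | succ n ih =>
    exact ih.union (((σ.toEquiv.measurableSet_image.2 ih).union (σ.toEquiv.measurable ih)).union
      ((τ.toEquiv.measurableSet_image.2 ih).union (τ.toEquiv.measurable ih)))

theorem monotone_orbitThickening (σ τ : MPMap p) (E : Set X) :
    Monotone (orbitThickening σ τ E) :=
  monotone_nat_of_le_succ fun _ => subset_union_left

theorem measure_orbitThickening_le (σ τ : MPMap p) (E : Set X) (n : ℕ) :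
    p (orbitThickening σ τ E n) ≤ 5 ^ n * p E := by
  induction n with
  | zero => simp [orbitThickening]
  | succ n ih =>
    refine (measure_union_le _ _).trans ((add_le_add le_rfl ((measure_union_le _ _).trans
      (add_le_add (measure_union_le _ _) (measure_union_le _ _)))).trans ?_)
    rw [measure_image, measure_image, measure_preimage, measure_preimage]
    calc _ = 5 * p (orbitThickening σ τ E n) := by ring
      _ ≤ 5 * (5 ^ n * p E) := by gcongr
      _ = 5 ^ (n + 1) * p E := by ring

/-- A cutoff that vanishes on `E`, varies slowly along the orbits of both maps, and equals `1` off a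
small set when `E` is small: the distance to `E` in the orbit graph, truncated at `N` and divided by
`N`. -/
theorem exists_cutoff (σ τ : MPMap p) {E : Set X} (hE : MeasurableSet E) {N : ℕ} (hN : 0 < N) :
    ∃ χ : X → ℝ, Measurable χ ∧ (∀ x, χ x ∈ Icc (0 : ℝ) 1) ∧ (∀ x ∈ E, χ x = 0) ∧
      (∀ x, |χ x - χ (σ x)| ≤ 1 / N) ∧ (∀ x, |χ x - χ (τ x)| ≤ 1 / N) ∧
      p {x | χ x ≠ 1} ≤ 5 ^ N * p E := by
  classical
  have hN' : (0 : ℝ) < N := by exact_mod_cast hN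
  set T := orbitThickening σ τ E with hT
  set m : X → ℝ := fun x => ∑ n ∈ Finset.range N, (T n)ᶜ.indicator 1 x with hm
  have hi0 : ∀ n x, 0 ≤ (T n)ᶜ.indicator (1 : X → ℝ) x := fun n x =>
    indicator_nonneg (fun _ _ => zero_le_one) x
  have hi1 : ∀ n x, (T n)ᶜ.indicator (1 : X → ℝ) x ≤ 1 := fun n x =>
    indicator_le_self' (fun _ _ => zero_le_one) x
  have hmm : Measurable m := Finset.measurable_sum _ fun n _ =>
    measurable_one.indicator (measurableSet_orbitThickening σ τ hE n).compl
  -- The truncated distance changes by at most one between neighbours.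
  have hnb : ∀ x y, (∀ n, y ∈ T n → x ∈ T (n + 1)) → m x ≤ m y + 1 := by
    intro x y hxy
    calc m x ≤ ∑ n ∈ Finset.range (N + 1), (T n)ᶜ.indicator (1 : X → ℝ) x :=
          Finset.sum_le_sum_of_subset_of_nonneg (Finset.range_subset_range.2 (Nat.le_succ N))
            fun n _ _ => hi0 n x
      _ = ∑ n ∈ Finset.range N, (T (n + 1))ᶜ.indicator (1 : X → ℝ) x +
            (T 0)ᶜ.indicator (1 : X → ℝ) x := Finset.sum_range_succ' _ _
      _ ≤ m y + 1 := by
          refine add_le_add (Finset.sum_le_sum fun n _ => ?_) (hi1 0 x)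
          by_cases hy : y ∈ T n
          · rw [indicator_of_notMem (by simpa using hxy n hy)]
            exact hi0 n y
          · rw [indicator_of_mem (show y ∈ (T n)ᶜ from hy)]
            exact hi1 _ x
  have hnb' : ∀ x y, (∀ n, y ∈ T n → x ∈ T (n + 1)) → (∀ n, x ∈ T n → y ∈ T (n + 1)) →
      |m x / N - m y / N| ≤ 1 / N := by
    intro x y h1 h2
    rw [← sub_div, abs_div, abs_of_pos hN']
    gcongr
    rw [abs_le]
    constructor <;> linarith [hnb x y h1, hnb y x h2]
  refine ⟨fun x => m x / N, hmm.div_const _, fun x => ⟨?_, ?_⟩, fun x hx => ?_, fun x => ?_,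
    fun x => ?_, ?_⟩
  · exact div_nonneg (Finset.sum_nonneg fun n _ => hi0 n x) hN'.le
  · rw [div_le_one hN']
    calc m x ≤ ∑ n ∈ Finset.range N, (1 : ℝ) := Finset.sum_le_sum fun n _ => hi1 n x
      _ = N := by simp
  · have : m x = 0 := Finset.sum_eq_zero fun n _ => indicator_of_notMem
      (by simpa using monotone_orbitThickening σ τ E (Nat.zero_le n) hx) _
    simp [this]
  · exact hnb' x (σ x) (fun n h => Or.inr (Or.inl (Or.inr h)))
      fun n h => Or.inr (Or.inl (Or.inl (mem_image_of_mem _ h)))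
  · exact hnb' x (τ x) (fun n h => Or.inr (Or.inr (Or.inr h)))
      fun n h => Or.inr (Or.inr (Or.inl (mem_image_of_mem _ h)))
  · refine (measure_mono fun x hx => ?_).trans (measure_orbitThickening_le σ τ E N)
    by_contra hxN
    refine hx ?_
    have : m x = N := by
      calc m x = ∑ n ∈ Finset.range N, (1 : ℝ) := Finset.sum_congr rfl fun n hn =>
            indicator_of_mem (show x ∈ (T n)ᶜ from fun h => hxN
              (monotone_orbitThickening σ τ E (Finset.mem_range.1 hn).le h)) _
        _ = N := by simp
    simp only [this]
    exact div_self hN'.ne'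

theorem measure_ne_comp_le (τ : MPMap p) {g : X → ℤ} {L : ℕ} (hL : ∀ x, g x ∈ Ico (-1 : ℤ) L)
    {η : ℝ≥0∞}
    (h : ∀ k ∈ Ico (-1 : ℤ) L, p (symmDiff (τ '' (g ⁻¹' {k})) (g ⁻¹' {k})) < η) :
    p {x | g (τ x) ≠ g x} ≤ (L + 1) * η := by
  have hsub : {x | g (τ x) ≠ g x} ⊆
      ⋃ k ∈ Finset.Ico (-1 : ℤ) L, symmDiff (g ⁻¹' {k}) (τ ⁻¹' (g ⁻¹' {k})) := fun x hx =>
    mem_biUnion (x := g x) (by simpa using hL x) (Or.inl ⟨rfl, hx⟩)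
  calc p {x | g (τ x) ≠ g x}
      ≤ ∑ k ∈ Finset.Ico (-1 : ℤ) L, p (symmDiff (g ⁻¹' {k}) (τ ⁻¹' (g ⁻¹' {k}))) :=
        (measure_mono hsub).trans (measure_biUnion_finset_le _ _)
    _ ≤ ∑ k ∈ Finset.Ico (-1 : ℤ) L, η := Finset.sum_le_sum fun k hk => by
        rw [← measure_symmDiff_image_left]
        exact (h k (by simpa using hk)).le
    _ = (L + 1) * η := by
        have : ((L : ℤ) + 1).toNat = L + 1 := by omega
        simp [this]

/-- A function `g` multiplied by a slowly varying cutoff is slowly varying along the orbits if the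
cutoff vanishes wherever `g` is not invariant. -/
theorem abs_mul_sub_mul_comp_le {τ : MPMap p} {g : X → ℤ} {L : ℕ}
    (hL : ∀ x, g x ∈ Ico (-1 : ℤ) (L + 1)) {χ : X → ℝ} {δ : ℝ} (hχ : ∀ x, |χ x - χ (τ x)| ≤ δ)
    (h0 : ∀ x, g (τ x) ≠ g x → χ x = 0) (x : X) :
    |χ x * g x - χ (τ x) * g (τ x)| ≤ (L + 1) * δ := by
  have hg : ∀ y, |(g y : ℝ)| ≤ L + 1 := fun y => by
    have h1 : (-1 : ℝ) ≤ g y := by exact_mod_cast (hL y).1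
    have h2 : (g y : ℝ) < L + 1 := by exact_mod_cast (hL y).2
    rw [abs_le]
    constructor <;> linarith [(Nat.cast_nonneg L : (0 : ℝ) ≤ L)]
  have hδ : |χ x - χ (τ x)| * |(g (τ x) : ℝ)| ≤ (L + 1) * δ := by
    rw [mul_comm]
    exact mul_le_mul (hg _) (hχ x) (abs_nonneg _) (by positivity)
  by_cases h : g (τ x) = g x
  · rw [h] at hδ ⊢
    rwa [← sub_mul, abs_mul]
  · rw [h0 x h, ← abs_mul, sub_mul] at hδ
    rwa [h0 x h, zero_mul] at *

end Cutoff

/-! ### Common coboundaries -/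

section Coboundary

variable {X : Type*} [MeasurableSpace X] {p : Measure X} {𝕜 : Type*} [RCLike 𝕜]

/-- A coboundary is nearly orthogonal to every almost invariant function. -/
theorem norm_integral_smul_coboundary_le (τ : MPMap p) {h : X → 𝕜} (hh : Integrable h p)
    {Φ : X → ℝ} (hΦ : Measurable Φ) {C : ℝ} (hC : ∀ x, |Φ x| ≤ C) {ε : ℝ}
    (hε : ∀ x, |Φ x - Φ (τ x)| ≤ ε) :
    ‖∫ x, Φ x • (h x - h (τ x)) ∂p‖ ≤ ε * ∫ x, ‖h x‖ ∂p := by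
  have hmp := τ.measurePreserving
  have hemb := τ.toEquiv.measurableEmbedding
  have hhτ : Integrable (fun x => h (τ x)) p := hmp.integrable_comp_of_integrable hh
  have hbdd : ∀ {u : X → 𝕜} {Ψ : X → ℝ}, Integrable u p → Measurable Ψ → (∀ x, |Ψ x| ≤ C) →
      Integrable (fun x => Ψ x • u x) p := fun hu hΨ hC =>
    hu.bdd_smul C hΨ.aestronglyMeasurable (Eventually.of_forall hC)
  have hΦτ : Measurable fun x => Φ (τ x) := hΦ.comp τ.toEquiv.measurable
  have h1 : ∫ x, Φ x • (h x - h (τ x)) ∂p = ∫ x, (Φ (τ x) - Φ x) • h (τ x) ∂p := by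
    simp only [smul_sub, sub_smul]
    rw [integral_sub (hbdd hh hΦ hC) (hbdd hhτ hΦ hC),
      integral_sub (hbdd hhτ hΦτ fun x => hC _) (hbdd hhτ hΦ hC),
      hmp.integral_comp hemb fun x => Φ x • h x]
  rw [h1, ← hmp.integral_comp hemb fun x => ‖h x‖, ← integral_const_mul]
  refine norm_integral_le_of_norm_le (hhτ.norm.const_mul ε) (Eventually.of_forall fun x => ?_)
  rw [norm_smul, Real.norm_eq_abs, abs_sub_comm]
  exact mul_le_mul_of_nonneg_right (hε x) (norm_nonneg _)

/-- The parameter `η` for which `almostSplit p A L η` forces the integral of a common coboundary over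
`A` to be small: it beats the size of the balls of radius `(L + 1) * (n + 1)` in the orbit graph. -/
noncomputable def splitTolerance (n L : ℕ) : ℝ≥0∞ :=
  ((n + 1) * (5 ^ ((L + 1) * (n + 1)) * (2 * (L + 1))))⁻¹

theorem splitTolerance_pos (n L : ℕ) : 0 < splitTolerance n L :=
  ENNReal.inv_pos.2 (by finiteness)

theorem exists_cutoff_norm_setIntegral_le {A : Set X} (hA : MeasurableSet A) {n L : ℕ}
    {σ τ : MPMap p} (hστ : (σ, τ) ∈ almostSplit p A L (splitTolerance n L)) :
    ∃ χ : X → ℝ, Measurable χ ∧ (∀ x, χ x ∈ Icc (0 : ℝ) 1) ∧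
      p {x | χ x ≠ 1} ≤ (n + 1 : ℝ≥0∞)⁻¹ ∧
      ∀ f g h : X → 𝕜, Integrable g p → Integrable h p → (f =ᵐ[p] fun x => g x - g (σ x)) →
        (f =ᵐ[p] fun x => h x - h (τ x)) →
        ‖∫ x in A, χ x • f x ∂p‖ ≤ (1 / (n + 1)) * (∫ x, ‖g x‖ ∂p + ∫ x, ‖h x‖ ∂p) := by
  obtain ⟨φ, hφ, hφL, h1, h2⟩ := hστ
  set ψ := remainder A φ with hψ
  have hψm : Measurable ψ := measurable_remainder hA hφ
  have hψL : ∀ x, ψ x ∈ Ico (-1 : ℤ) L := fun x => by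
    have := hφL x
    simp only [hψ, remainder, indicator, Pi.one_apply, mem_Ico] at this ⊢
    split_ifs <;> omega
  have hφL' : ∀ x, φ x ∈ Ico (-1 : ℤ) L := fun x => ⟨by linarith [(hφL x).1], (hφL x).2⟩
  set E : Set X := {x | φ (σ x) ≠ φ x} ∪ {x | ψ (τ x) ≠ ψ x} with hE
  have hEm : MeasurableSet E :=
    (measurableSet_eq_fun (hφ.comp σ.toEquiv.measurable) hφ).compl.union
      (measurableSet_eq_fun (hψm.comp τ.toEquiv.measurable) hψm).compl
  have hEp : p E ≤ 2 * (L + 1) * splitTolerance n L :=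
    calc p E ≤ (L + 1) * splitTolerance n L + (L + 1) * splitTolerance n L :=
          (measure_union_le _ _).trans
            (add_le_add (measure_ne_comp_le σ hφL' h1) (measure_ne_comp_le τ hψL h2))
      _ = 2 * (L + 1) * splitTolerance n L := by ring
  obtain ⟨χ, hχm, hχ01, hχE, hχσ, hχτ, hχp⟩ :=
    exists_cutoff σ τ hEm (N := (L + 1) * (n + 1)) (by positivity)
  have hδ : ((L : ℝ) + 1) * (1 / (((L + 1) * (n + 1) : ℕ) : ℝ)) = 1 / (n + 1) := by
    push_cast
    field_simp
  have hbd : ∀ g : X → ℤ, (∀ x, g x ∈ Ico (-1 : ℤ) L) → ∀ x, |χ x * g x| ≤ L + 1 := by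
    intro g hg x
    have h1 : (-1 : ℝ) ≤ g x := by exact_mod_cast (hg x).1
    have h2 : (g x : ℝ) < L := by exact_mod_cast (hg x).2
    have h3 : |(g x : ℝ)| ≤ L + 1 := abs_le.2 ⟨by linarith, by linarith⟩
    rw [abs_mul, abs_of_nonneg (hχ01 x).1]
    exact (mul_le_of_le_one_left (abs_nonneg _) (hχ01 x).2).trans h3
  have hweak : ∀ {g : X → ℤ}, (∀ x, g x ∈ Ico (-1 : ℤ) L) → ∀ x, g x ∈ Ico (-1 : ℤ) (L + 1) :=
    fun hg x => ⟨(hg x).1, by linarith [(hg x).2]⟩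
  refine ⟨χ, hχm, hχ01, ?_, fun f g h hg hh hfg hfh => ?_⟩
  · refine hχp.trans ?_
    calc 5 ^ ((L + 1) * (n + 1)) * p E
        ≤ 5 ^ ((L + 1) * (n + 1)) * (2 * (L + 1) * splitTolerance n L) := by gcongr
      _ = 5 ^ ((L + 1) * (n + 1)) * (2 * (L + 1)) * splitTolerance n L := by ring
      _ = (n + 1 : ℝ≥0∞)⁻¹ := by
          rw [splitTolerance, ENNReal.mul_inv (Or.inr (by finiteness)) (Or.inl (by finiteness)),
            mul_comm, mul_assoc, ENNReal.inv_mul_cancel (by positivity) (by finiteness), mul_one]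
  · have hΦm : Measurable fun x => χ x * (φ x : ℝ) :=
      hχm.mul ((measurable_from_top (f := fun z : ℤ => (z : ℝ))).comp hφ)
    have hΨm : Measurable fun x => χ x * (ψ x : ℝ) :=
      hχm.mul ((measurable_from_top (f := fun z : ℤ => (z : ℝ))).comp hψm)
    have hfi : Integrable f p :=
      (hg.sub (σ.measurePreserving.integrable_comp_of_integrable hg)).congr hfg.symm
    have e1 := norm_integral_smul_coboundary_le σ hg hΦm (hbd φ hφL')
      (abs_mul_sub_mul_comp_le (hweak hφL') hχσ fun x hx => hχE x (Or.inl hx))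
    have e2 := norm_integral_smul_coboundary_le τ hh hΨm (hbd ψ hψL)
      (abs_mul_sub_mul_comp_le (hweak hψL) hχτ fun x hx => hχE x (Or.inr hx))
    rw [hδ] at e1 e2
    have i1 : ∫ x, (χ x * (φ x : ℝ)) • (g x - g (σ x)) ∂p = ∫ x, (χ x * (φ x : ℝ)) • f x ∂p :=
      integral_congr_ae (by filter_upwards [hfg] with x hx; rw [hx])
    have i2 : ∫ x, (χ x * (ψ x : ℝ)) • (h x - h (τ x)) ∂p = ∫ x, (χ x * (ψ x : ℝ)) • f x ∂p :=
      integral_congr_ae (by filter_upwards [hfh] with x hx; rw [hx])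
    have hsplit : ∫ x in A, χ x • f x ∂p =
        ∫ x, (χ x * (φ x : ℝ)) • f x ∂p - ∫ x, (χ x * (ψ x : ℝ)) • f x ∂p := by
      have j1 : Integrable (fun x => (χ x * (φ x : ℝ)) • f x) p :=
        hfi.bdd_smul (L + 1) hΦm.aestronglyMeasurable (Eventually.of_forall (hbd φ hφL'))
      have j2 : Integrable (fun x => (χ x * (ψ x : ℝ)) • f x) p :=
        hfi.bdd_smul (L + 1) hΨm.aestronglyMeasurable (Eventually.of_forall (hbd ψ hψL))
      rw [← integral_indicator hA, ← integral_sub j1 j2]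
      congr 1
      ext x
      rw [← sub_smul, ← mul_sub]
      by_cases hx : x ∈ A <;> simp [hψ, remainder, hx]
    rw [hsplit, ← i1, ← i2, mul_add]
    exact (norm_sub_le _ _).trans (add_le_add e1 e2)

/-- If the indicator of `A` splits to every precision, common coboundaries have mean zero over
`A`. -/
theorem setIntegral_eq_zero_of_forall_mem_almostSplit {A : Set X} (hA : MeasurableSet A)
    {σ τ : MPMap p} (hστ : ∀ n : ℕ, (σ, τ) ∈ ⋃ L, almostSplit p A L (splitTolerance n L))
    {f g h : X → 𝕜} (hg : Integrable g p) (hh : Integrable h p)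
    (hfg : f =ᵐ[p] fun x => g x - g (σ x)) (hfh : f =ᵐ[p] fun x => h x - h (τ x)) :
    ∫ x in A, f x ∂p = 0 := by
  have hfi : Integrable f p :=
    (hg.sub (σ.measurePreserving.integrable_comp_of_integrable hg)).congr hfg.symm
  choose L hL using fun n => mem_iUnion.1 (hστ n)
  choose χ hχm hχ01 hχp hχ using fun n =>
    exists_cutoff_norm_setIntegral_le (𝕜 := 𝕜) hA (hL n)
  have hsm : ∀ n, MeasurableSet {x | χ n x ≠ 1} := fun n =>
    (measurableSet_eq_fun (hχm n) measurable_const).compl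
  have hp0 : Tendsto (fun n => p {x | χ n x ≠ 1}) atTop (𝓝 0) := by
    refine tendsto_of_tendsto_of_tendsto_of_le_of_le tendsto_const_nhds ?_ (fun n => bot_le) hχp
    exact_mod_cast (tendsto_add_atTop_iff_nat 1).2 ENNReal.tendsto_inv_nat_nhds_zero
  have hlim1 := hfi.norm.tendsto_setIntegral_nhds_zero hp0
  have hlim2 : Tendsto (fun n : ℕ => (1 / ((n : ℝ) + 1)) * (∫ x, ‖g x‖ ∂p + ∫ x, ‖h x‖ ∂p)) atTop
      (𝓝 0) := by
    simpa using (tendsto_one_div_add_atTop_nhds_zero_nat (𝕜 := ℝ)).mul_const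
      (∫ x, ‖g x‖ ∂p + ∫ x, ‖h x‖ ∂p)
  have hlim := hlim1.add hlim2
  rw [add_zero] at hlim
  refine norm_le_zero_iff.1 (ge_of_tendsto' hlim fun n => ?_)
  have hχf : Integrable (fun x => χ n x • f x) p :=
    hfi.bdd_smul 1 (hχm n).aestronglyMeasurable (Eventually.of_forall fun x => by
      rw [Real.norm_eq_abs, abs_of_nonneg (hχ01 n x).1]
      exact (hχ01 n x).2)
  have hdiff : ‖∫ x in A, f x ∂p - ∫ x in A, χ n x • f x ∂p‖ ≤
      ∫ x in {x | χ n x ≠ 1}, ‖f x‖ ∂p := by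
    rw [← integral_sub hfi.integrableOn hχf.integrableOn, ← integral_indicator (hsm n)]
    refine (norm_integral_le_of_norm_le (hfi.norm.indicator (hsm n)).integrableOn
      (Eventually.of_forall fun x => ?_)).trans
      (setIntegral_le_integral (hfi.norm.indicator (hsm n))
        (Eventually.of_forall fun x => indicator_nonneg (fun _ _ => norm_nonneg _) x))
    by_cases hx : χ n x = 1
    · simp [hx]
    · rw [indicator_of_mem (show x ∈ {x | χ n x ≠ 1} from hx), ← one_smul ℝ (f x), smul_smul,
        mul_one, ← sub_smul, norm_smul, norm_smul, norm_one, one_mul]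
      refine mul_le_of_le_one_left (norm_nonneg _) ?_
      rw [Real.norm_eq_abs, abs_le]
      constructor <;> linarith [(hχ01 n x).1, (hχ01 n x).2]
  calc ‖∫ x in A, f x ∂p‖
      = ‖(∫ x in A, f x ∂p - ∫ x in A, χ n x • f x ∂p) + ∫ x in A, χ n x • f x ∂p‖ := by
        rw [sub_add_cancel]
    _ ≤ _ := (norm_add_le _ _).trans (add_le_add hdiff (hχ n f g h hg hh hfg hfh))

/-- An integrable function with mean zero over the sets of a generating `π`-system, and over the
whole space, vanishes almost everywhere. -/
theorem ae_eq_zero_of_forall_setIntegral_Iic_eq_zero {e : X → ℝ} (he : MeasurableEmbedding e)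
    {f : X → 𝕜} (hf : Integrable f p) (h0 : ∫ x, f x ∂p = 0)
    (hq : ∀ q : ℚ, ∫ x in e ⁻¹' Iic (q : ℝ), f x ∂p = 0) : f =ᵐ[p] 0 := by
  suffices ∀ s, MeasurableSet s → ∫ x in s, f x ∂p = 0 from
    hf.ae_eq_zero_of_forall_setIntegral_eq_zero fun s hs _ => this s hs
  intro s hs
  have hgen : ‹MeasurableSpace X› =
      MeasurableSpace.generateFrom (preimage e '' (⋃ q : ℚ, {Iic (q : ℝ)})) := by
    rw [← MeasurableSpace.comap_generateFrom, ← Real.borel_eq_generateFrom_Iic_rat,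
      ← BorelSpace.measurable_eq, he.comap_eq]
  induction s, hs using MeasurableSpace.induction_on_inter hgen
    (Real.isPiSystem_Iic_rat.comap e) with
  | empty => simp
  | basic t ht =>
    obtain ⟨_, hs, rfl⟩ := ht
    obtain ⟨q, rfl⟩ := mem_iUnion.1 hs
    exact hq q
  | compl t ht ih =>
    have := integral_add_compl ht hf
    rwa [ih, zero_add, h0] at this
  | iUnion t hd ht ih =>
    rw [integral_iUnion ht hd hf.integrableOn]
    simp [ih]

end Coboundary
end MPMap

theorem mainTheorem5 {X : Type*} [MeasurableSpace X] [StandardBorelSpace X]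
    (p : Measure X) [IsProbabilityMeasure p] [NullSingletonClass p] (𝕜 : Type*) [RCLike 𝕜] :
    ∃ G : Set (MPMap p × MPMap p), IsGδ G ∧ Dense G ∧
      ∀ σ τ : MPMap p, (σ, τ) ∈ G →
        ∀ r : ℝ≥0∞, 1 ≤ r → MPMap.NoCommonCoboundary 𝕜 σ τ r := by
  have he := measurableEmbedding_embeddingReal X
  have hA : ∀ q : ℚ, MeasurableSet (embeddingReal X ⁻¹' Iic (q : ℝ)) := fun q =>
    he.measurable measurableSet_Iic
  have hopen : ∀ i : ℚ × ℕ, IsOpen (⋃ L, MPMap.almostSplit p (embeddingReal X ⁻¹' Iic (i.1 : ℝ)) L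
      (MPMap.splitTolerance i.2 L)) := fun i => isOpen_iUnion fun L =>
    MPMap.isOpen_almostSplit (hA _) L (MPMap.splitTolerance_pos _ _)
  refine ⟨⋂ i : ℚ × ℕ, ⋃ L, MPMap.almostSplit p (embeddingReal X ⁻¹' Iic (i.1 : ℝ)) L
    (MPMap.splitTolerance i.2 L), IsGδ.iInter_of_isOpen hopen, dense_iInter_of_isOpen hopen
    fun i => MPMap.dense_iUnion_almostSplit (hA _) fun L => MPMap.splitTolerance_pos _ _, ?_⟩
  rintro σ τ hστ r hr f ⟨g, hg, -, hfg⟩ ⟨h, hh, -, hfh⟩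
  have hgi := hg.integrable hr
  have hhi := hh.integrable hr
  have hgσ : Integrable (fun x => g (σ x)) p :=
    σ.measurePreserving.integrable_comp_of_integrable hgi
  refine MPMap.ae_eq_zero_of_forall_setIntegral_Iic_eq_zero he
    ((hgi.sub hgσ).congr hfg.symm) ?_ fun q =>
      MPMap.setIntegral_eq_zero_of_forall_mem_almostSplit (hA q)
        (fun n => mem_iInter.1 hστ (q, n)) hgi hhi hfg hfh
  rw [integral_congr_ae hfg, integral_sub hgi hgσ,
    σ.measurePreserving.integral_comp σ.toEquiv.measurableEmbedding, sub_self]
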